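/- \textbf{Setting.} Let $f_0$ and $\{f_\theta\}_{\theta\in\Theta}$ be probability densities on an observation space with respect to a common reference measure, such that, for every $\theta\in\Theta$, the divergences $D(f_\theta\,\|\,f_0)$ and $D(f_0\,\|\,f_\theta)$ are finite and positive. The observations $X_1,X_2,\dots$ are independent; under $\mathbb P^\theta_\gamma$ ($\gamma\ge1$) $X_1,\dots,X_{\gamma-1}$ have density $f_0$ and $X_\gamma,X_{\gamma+1},\dots$ have density $f_\theta$; under $\mathbb P_\infty$ all have density $f_0$. A policy $\Psi$ consists of measurable control maps, which decide from the information $\mathcal I_{n-1}=(X_1^{(S_1)},\dots,X_{n-1}^{(S_{n-1})})$ whether the observation $X_n$ is used ($S_n=1$) or skipped ($S_n=0$, and $X_n$ is absent from $\mathcal I_n$), and of a stopping time $\tau$ of $(\sigma(\mathcal I_n))_n$. Put $$\mathsf{FAR}(\Psi)=\frac1{\mathbb E_\infty[\tau]},\qquad \mathsf{PDC}(\Psi)=\limsup_{\gamma\to\infty}\mathbb E_\infty\Big[\frac1\gamma\sum_{n=1}^{\gamma-1}S_n\Big],$$ $$\mathsf{CADD}^\theta(\Psi)=\sup_{\gamma\ge1}\mathbb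 E^\theta_\gamma[\tau-\gamma\mid\tau\ge\gamma],\qquad \mathsf{WADD}^\theta(\Psi)=\sup_{\gamma\ge1}\operatorname{ess\,sup}\,\mathbb E^\theta_\gamma[(\tau-\gamma)^+\mid\mathcal I_{\gamma-1}].$$ Problem 1 (resp. Problem 2) with constraints $\alpha,\beta$ is to minimize $\mathsf J=\mathsf{CADD}^\theta$ (resp. $\mathsf J=\mathsf{WADD}^\theta$) over all policies with $\mathsf{FAR}(\Psi)\le\alpha$ and $\mathsf{PDC}(\Psi)\le\beta$. Let $r(\alpha)\to0$ as $\alpha\downarrow 0$ be a tolerance ($r\equiv0$ is allowed). Policies $\Psi_\alpha$ that do not depend on $\theta$ are called uniformly asymptotically optimal for the problem with constraint $\beta$, as $\alpha\to0$, if for all small $\alpha>0$ they are policies with $\mathsf{FAR}(\Psi_\alpha)\le\alpha(1+r(\alpha))$ and $\mathsf{PDC}(\Psi_\alpha)\le\beta$, and if for every $\theta\in\Theta$ $$\mathsf J^\theta(\Psi_\alpha)\le(1+o(1))\,\inf\{\mathsf J^\theta(\Psi):\ \mathsf{FAR}(\Psi)\le\alpha,\ \mathsf{PDC}(\Psi)\le\beta\}\quad\text{as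 }\alpha\to0 .$$ \textbf{The tests.} Let $\Theta'(\alpha)\subset\Theta$ be sets such that each $\theta\in\Theta$ belongs to $\Theta'(\alpha)$ for all small $\alpha$ (for example $\Theta'(\alpha)=\Theta$), and let $A_\alpha\in\mathbb R$ be thresholds. The GCuSum test uses all observations and stops at $$\tau_{\rm GC}=\inf\Big\{n\ge1:\ \max_{1\le k\le n}\ \sup_{\theta\in\Theta'(\alpha)}\ \sum_{i=k}^n\log\frac{f_\theta(X_i)}{f_0(X_i)}\ge A_\alpha\Big\}.$$ Let $\theta^*\in\Theta$ be such that $\mathbb E^\theta_1\big[\log\frac{f_{\theta^*}(X_1)}{f_0(X_1)}\big]>0$ for every $\theta\in\Theta$, and let $\mu>0$, $0\le h<\infty$. The GDECuSum test starts with $W_0=0$; if $W_{n-1}\ge0$, then $X_n$ is used and $W_n=\max\{W_{n-1}+\log\frac{f_{\theta^*}(X_n)}{f_0(X_n)},-h\}$; if $W_{n-1}<0$, then $X_n$ is skipped and $W_n=\min\{W_{n-1}+\mu,0\}$. It stops at $$\tau_{\rm GD}=\inf\Big\{n\ge1:\ \max_{1\le k\le n}\ \sup_{\theta\in\Theta'(\alpha)}\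 \sum_{i=k}^n S_i\log\frac{f_\theta(X_i)}{f_0(X_i)}\ge A_\alpha\Big\}.$$ Its $\mathsf{PDC}$ depends on $\theta^*,\mu,h$ only. \textbf{Claim.} Let $\beta\in(0,1]$ be fixed. (a) For every $h\in(0,\infty)$ there is $\mu_0>0$ such that for all $\mu\in(0,\mu_0]$ the GDECuSum test has $\mathsf{PDC}\le\beta$. (b) Let $\mu>0$ and $0\le h<\infty$ be such that the GDECuSum test has $\mathsf{PDC}\le\beta$. If the GCuSum tests with thresholds $A_\alpha$ are uniformly asymptotically optimal for Problem 1 with constraint $1$ in place of $\beta$, then the GDECuSum tests with parameters $\mu$, $h$ and the same $A_\alpha$, $\Theta'(\alpha)$ are uniformly asymptotically optimal for Problem 1 with the constraint $\beta$, as $\alpha\to0$. The same holds for Problem 2. -/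

import Mathlib

open MeasureTheory ProbabilityTheory InformationTheory Filter Topology
open scoped ENNReal NNReal

noncomputable section

namespace QCD

/-- The statistical model: a pre-change density `f₀` and a family `f θ` of post-change densities
on the observation space `𝓧`, all with respect to the same reference measure `ν`. -/
structure Model (𝓧 Θ : Type*) [MeasurableSpace 𝓧] where
  ν : Measure 𝓧
  f₀ : 𝓧 → ℝ≥0
  f : Θ → 𝓧 → ℝ≥0
  measurable_f₀ : Measurable f₀
  measurable_f : ∀ θ, Measurable (f θ)
  lintegral_f₀ : ∫⁻ x, (f₀ x : ℝ≥0∞) ∂ν = 1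
  lintegral_f : ∀ θ, ∫⁻ x, (f θ x : ℝ≥0∞) ∂ν = 1

/-! ### Observation control and policies -/

/-- What is recorded at one time instant: `Sum.inl x` if the observation `x` is used,
`Sum.inr ()` if it is skipped. -/
abbrev Obs (𝓧 : Type*) := 𝓧 ⊕ Unit

/-- A sequence of control maps. `φ n`, applied to the information `I_n` available at time `n`,
decides whether the observation `X_{n+1}` is used (`true`) or skipped (`false`). -/
abbrev Control (𝓧 : Type*) := (n : ℕ) → (Fin n → Obs 𝓧) → Bool

/-- The information `I_n = (X_1^{(S_1)}, …, X_n^{(S_n)})` available at time `n` under the control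
`φ`. A sample path is `ω : ℕ → 𝓧`, where `ω i` is the observation `X_{i+1}`. -/
def record {𝓧 : Type*} (φ : Control 𝓧) : (n : ℕ) → (ℕ → 𝓧) → (Fin n → Obs 𝓧)
  | 0, _ => fun i => i.elim0
  | n + 1, ω =>
    Fin.snoc (α := fun _ => Obs 𝓧) (record φ n ω)
      (if φ n (record φ n ω) then Sum.inl (ω n) else Sum.inr ())

/-- The indicator `S_{n+1} = φ_{n+1}(I_n)` that the observation `X_{n+1}` is used. -/
def used {𝓧 : Type*} (φ : Control 𝓧) (n : ℕ) (ω : ℕ → 𝓧) : Bool :=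
  φ n (record φ n ω)

/-- The σ-algebra generated by the information `I_n`. -/
abbrev infoSigma {𝓧 : Type*} [MeasurableSpace 𝓧] (φ : Control 𝓧) (n : ℕ) :
    MeasurableSpace (ℕ → 𝓧) :=
  MeasurableSpace.comap (record φ n) inferInstance

/-- A pair consisting of an observation control and a (possibly infinite) time of alarm. -/
structure Policy (𝓧 : Type*) where
  control : Control 𝓧
  alarm : (ℕ → 𝓧) → ℕ∞

/-- A control policy: the control maps are measurable and the alarm time is a stopping time for
the information sequence `I_0, I_1, …`. -/
def Policy.IsAdmissible {𝓧 : Type*} [MeasurableSpace 𝓧] (Ψ : Policy 𝓧) : Prop :=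
  (∀ n, Measurable (Ψ.control n)) ∧
    ∀ n : ℕ, MeasurableSet[infoSigma Ψ.control n] {ω | Ψ.alarm ω ≤ (n : ℕ∞)}

namespace Model

variable {𝓧 Θ : Type*} [MeasurableSpace 𝓧] (M : Model 𝓧 Θ)

/-! ### Laws of the observations -/

/-- The pre-change law of one observation. -/
def P₀ : Measure 𝓧 := M.ν.withDensity fun x => (M.f₀ x : ℝ≥0∞)

/-- The post-change law of one observation, with post-change parameter `θ`. -/
def P (θ : Θ) : Measure 𝓧 := M.ν.withDensity fun x => (M.f θ x : ℝ≥0∞)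

/-- The law of the observation sequence when the change never occurs. -/
def Pinf : Measure (ℕ → 𝓧) := Measure.infinitePi fun _ => M.P₀

/-- The law of the observation sequence when the change occurs at time `γ ≥ 1` with post-change
parameter `θ`: the independent observations `X_1, …, X_{γ-1}` have density `f₀` and
`X_γ, X_{γ+1}, …` have density `f θ`. -/
def Pchange (θ : Θ) (γ : ℕ) : Measure (ℕ → 𝓧) :=
  Measure.infinitePi fun i => if i + 1 < γ then M.P₀ else M.P θ

/-- The log-likelihood ratio `log (f θ x / f₀ x)`, with values in the extended reals. -/
def llr (θ : Θ) (x : 𝓧) : EReal := ENNReal.log ((M.f θ x : ℝ≥0∞) / (M.f₀ x : ℝ≥0∞))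

/-- The Kullback-Leibler divergences `D(f_θ ‖ f₀)` and `D(f₀ ‖ f_θ)` are finite and positive for
every `θ`. -/
def HasFinitePosDivergences : Prop :=
  ∀ θ, (0 < klDiv (M.P θ) M.P₀ ∧ klDiv (M.P θ) M.P₀ < ∞) ∧
    (0 < klDiv M.P₀ (M.P θ) ∧ klDiv M.P₀ (M.P θ) < ∞)

/-- `f θs` is least favorable: `log (f θs / f₀)` has positive mean under every post-change law. -/
def IsLeastFavorable (θs : Θ) : Prop :=
  ∀ θ, 0 < ∫ x, (M.llr θs x).toReal ∂(M.P θ)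

/-! ### Performance metrics -/

/-- The false alarm rate `1 / E_∞[τ]`. -/
def FAR (Ψ : Policy 𝓧) : ℝ≥0∞ := (∫⁻ ω, (Ψ.alarm ω : ℝ≥0∞) ∂M.Pinf)⁻¹

/-- The pre-change duty cycle `limsup_{γ → ∞} E_∞[(1/γ) ∑_{n=1}^{γ-1} S_n]`; it depends on the
observation control only. -/
def PDC (φ : Control 𝓧) : ℝ≥0∞ :=
  limsup (fun γ : ℕ =>
    ∫⁻ ω, (∑ n ∈ Finset.range (γ - 1), if used φ n ω then (1 : ℝ≥0∞) else 0) / (γ : ℝ≥0∞)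
      ∂M.Pinf) atTop

/-- Pollak's conditional average detection delay `sup_{γ ≥ 1} E^θ_γ[τ - γ | τ ≥ γ]`, where
the supremum effectively runs over the `γ` for which `τ ≥ γ` has positive probability. -/
def CADD (θ : Θ) (Ψ : Policy 𝓧) : ℝ≥0∞ :=
  ⨆ γ : ℕ, ⨆ _ : 1 ≤ γ,
    ∫⁻ ω, ((Ψ.alarm ω : ℝ≥0∞) - (γ : ℝ≥0∞))
      ∂(ProbabilityTheory.cond (M.Pchange θ γ) {ω | (γ : ℕ∞) ≤ Ψ.alarm ω})

/-- Lorden's worst case average detection delay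
`sup_{γ ≥ 1} ess sup E^θ_γ[(τ - γ)⁺ | I_{γ-1}]`. -/
def WADD (θ : Θ) (Ψ : Policy 𝓧) : ℝ≥0∞ :=
  ⨆ γ : ℕ, ⨆ _ : 1 ≤ γ,
    essSup
      (condLExp (infoSigma Ψ.control (γ - 1)) (M.Pchange θ γ)
        (fun ω => (Ψ.alarm ω : ℝ≥0∞) - (γ : ℝ≥0∞)))
      (M.Pchange θ γ)

/-! ### Optimality -/

/-- The constraints of the optimization problems: `FAR ≤ α` and `PDC ≤ β`. -/
def Feasible (α β : ℝ) (Ψ : Policy 𝓧) : Prop :=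
  Ψ.IsAdmissible ∧ M.FAR Ψ ≤ ENNReal.ofReal α ∧ M.PDC Ψ.control ≤ ENNReal.ofReal β

/-- The policies `Ψ α`, which may not depend on the unknown parameter `θ`, are uniformly
asymptotically optimal, as `α → 0`, for minimizing the delay metric `J` subject to `FAR ≤ α` and
`PDC ≤ β`. For small `α` the policy `Ψ α` satisfies the constraints, the first of them in the form
`FAR ≤ α (1 + r α)` (exactly if `r = 0`), and for each `θ` its delay is at most `1 + o(1)` times
the smallest delay of all policies that satisfy the constraints. -/
def UniformlyAsymptoticallyOptimal (J : Θ → Policy 𝓧 → ℝ≥0∞) (β : ℝ) (r : ℝ → ℝ)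
    (Ψ : ℝ → Policy 𝓧) : Prop :=
  (∀ᶠ α in 𝓝[>] (0 : ℝ), (Ψ α).IsAdmissible ∧
    M.FAR (Ψ α) ≤ ENNReal.ofReal (α * (1 + r α)) ∧ M.PDC (Ψ α).control ≤ ENNReal.ofReal β) ∧
  ∀ θ, ∀ ε : ℝ, 0 < ε → ∀ᶠ α in 𝓝[>] (0 : ℝ),
    J θ (Ψ α) ≤ ENNReal.ofReal (1 + ε) *
      ⨅ Ψ' : Policy 𝓧, ⨅ _ : M.Feasible α β Ψ', J θ Ψ'

/-! ### The two tests -/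

/-- The log-likelihood ratio of a recorded observation; it is `0` for a skipped one. -/
def llrObs (θ : Θ) : Obs 𝓧 → EReal
  | Sum.inl x => M.llr θ x
  | Sum.inr _ => 0

/-- The generalized likelihood ratio statistic
`max_{1 ≤ k ≤ n} sup_{θ ∈ T} ∑_{i=k}^n log (f_θ(X_i^{(S_i)}) / f₀(X_i^{(S_i)}))`. -/
def glr (T : Set Θ) (n : ℕ) (I : Fin n → Obs 𝓧) : EReal :=
  ⨆ k : Fin n, ⨆ θ ∈ T, ∑ i ∈ Finset.Ici k, M.llrObs θ (I i)

/-- The first time `n ≥ 1` at which the generalized likelihood ratio statistic, computed from the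
observations that the control `φ` uses, reaches the threshold `A`. -/
def crossingTime (φ : Control 𝓧) (T : Set Θ) (A : ℝ) (ω : ℕ → 𝓧) : ℕ∞ :=
  ⨅ n : ℕ, ⨅ _ : 1 ≤ n ∧ (A : EReal) ≤ M.glr T n (record φ n ω), (n : ℕ∞)

/-- The GCuSum test: all observations are used, and the alarm is raised when the generalized
likelihood ratio statistic over the parameter set `T` reaches `A`. -/
def GCuSum (T : Set Θ) (A : ℝ) : Policy 𝓧 where
  control := fun _ _ => true
  alarm := M.crossingTime (fun _ _ => true) T A

/-- The DECuSum statistic `W_n(θs)`, with parameters `μ` and `h`, as a function of the record: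
`W_0 = 0`; after a used observation `W_{n+1} = max (W_n + log (f_θs / f₀)) (-h)`; after a skipped
one `W_{n+1} = min (W_n + μ) 0`. -/
def W (θs : Θ) (μ h : ℝ) : (n : ℕ) → (Fin n → Obs 𝓧) → EReal
  | 0, _ => 0
  | n + 1, I =>
    match I (Fin.last n) with
    | Sum.inl x => max (W θs μ h n (Fin.init I) + M.llr θs x) ((-h : ℝ) : EReal)
    | Sum.inr _ => min (W θs μ h n (Fin.init I) + (μ : EReal)) 0

open Classical in
/-- The DECuSum observation control: the next observation is used if and only if the current
value of the statistic `W_n(θs)` is nonnegative. -/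
def deControl (θs : Θ) (μ h : ℝ) : Control 𝓧 := fun n I => decide (0 ≤ M.W θs μ h n I)

/-- The GDECuSum test: observations are used or skipped according to the DECuSum control designed
for `f θs`, and the alarm is raised when the generalized likelihood ratio statistic over `T` of the
used observations reaches `A`. -/
def GDECuSum (θs : Θ) (μ h : ℝ) (T : Set Θ) (A : ℝ) : Policy 𝓧 where
  control := M.deControl θs μ h
  alarm := M.crossingTime (M.deControl θs μ h) T A

end Model

end QCD

end

/-!
The GDECuSum test is compared with the GCuSum test through potential functions (Foster–Lyapunov
bounds) for processes that are driven by the observations one at a time,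
`IsDriven.foster_lyapunov`.

*Duty cycle.* Before the change the increments of the DECuSum statistic have negative mean. Hence
an excursion above zero, started at zero, has a finite mean length, and it ends below zero at a
point whose mean distance from zero, truncated at `h`, is positive. The return to zero takes a
number of skipped observations which is at least that distance divided by `μ`, so that the
fraction of used observations vanishes with `μ` (`HasFinitePosDivergences.exists_PDC_le`). Both
quantities are instances of `walkCost`, the expected cost of a random walk that is stopped below
zero.

*False alarms.* For a positive threshold, skipped observations leave the test statistic unchanged
as far as crossing is concerned, so that the GDECuSum test stops when the GCuSum test, applied to
the buffer of used observations, would stop (`lt_crossingTime_iff_buffer`). Since the decision to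
use an observation does not depend on its value, the used observations are again independent with
the same law, and skipping only delays the alarm (`FAR_GDECuSum_le`).

*Delay.* After the change the increments of the DECuSum statistic have positive mean, so by the
strong law of large numbers the statistic stays nonnegative forever with positive probability
after each visit to zero. Therefore the expected number of skipped observations after the change
is bounded by a constant (`HasFinitePosDivergences.exists_skip_potential`). As the test statistic
dominates the one that is started afresh at the change, the delay of the GDECuSum test, given
any past, exceeds the mean stopping time `E₁ τ` of the GCuSum test by at most that constant
(`HasFinitePosDivergences.exists_delay_bound`), while both delay metrics of the GCuSum test are at
least `E₁ τ - 1`.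

*A bounded difference is negligible.* A vanishing false alarm rate of the GCuSum tests makes
`E₁ τ` tend to infinity: if the test stopped within a fixed number of observations with
probability one half under the post-change law, it would do so with a fixed positive probability
before the change, and repeated trials would bound its mean time to false alarm
(`HasFinitePosDivergences.exists_le_lintegral_alarm`). The same reasoning shows that the threshold
is positive in the end (`FAR_GCuSum_ge_of_nonpos`). Finally, the optimal delay under the
constraint `β ≤ 1` is at least the one under the constraint `1`.
-/

namespace QCD

/-! ### Product measures and one-step decompositions -/

section OneStep

variable {𝓧 : Type*} [MeasurableSpace 𝓧]

lemma measurable_update_coord (n : ℕ) :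
    Measurable fun q : (ℕ → 𝓧) × 𝓧 => Function.update q.1 n q.2 := by
  refine measurable_pi_iff.2 fun i => ?_
  by_cases hi : i = n
  · subst hi
    simpa using measurable_snd
  · simpa [Function.update_of_ne hi] using! (measurable_pi_apply i).comp measurable_fst

/-- Replacing one coordinate of a random sequence with product law by an independent observation
with law `κ` replaces the corresponding factor of the product law by `κ`. -/
lemma map_update_infinitePi (μ : ℕ → Measure 𝓧) [∀ i, IsProbabilityMeasure (μ i)] (n : ℕ)
    (κ : Measure 𝓧) [IsProbabilityMeasure κ] :
    ((Measure.infinitePi μ).prod κ).map (fun q => Function.update q.1 n q.2) =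
      Measure.infinitePi (Function.update μ n κ) := by
  have : ∀ i, IsProbabilityMeasure (Function.update μ n κ i) := fun i => by
    by_cases hi : i = n
    · subst hi
      simpa
    · rw [Function.update_of_ne hi]
      infer_instance
  refine Measure.eq_infinitePi _ fun s t ht => ?_
  rw [Measure.map_apply (measurable_update_coord n)
    (MeasurableSet.pi s.countable_toSet fun i _ => ht i)]
  classical
  have hpre : (fun q : (ℕ → 𝓧) × 𝓧 => Function.update q.1 n q.2) ⁻¹' Set.pi s t =
      (Set.pi (s.erase n : Finset ℕ) t) ×ˢ (if n ∈ s then t n else Set.univ) := by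
    ext ⟨y, x⟩
    simp only [Set.mem_preimage, Set.mem_pi, Set.mem_prod, Finset.coe_erase, Set.mem_sdiff,
      Finset.mem_coe, Set.mem_singleton_iff]
    constructor
    · intro h
      refine ⟨fun i hi => ?_, ?_⟩
      · simpa [Function.update_of_ne hi.2] using h i hi.1
      · split_ifs with hn
        · simpa using h n hn
        · trivial
    · rintro ⟨h1, h2⟩ i hi
      by_cases hin : i = n
      · subst hin
        simpa [hi] using h2
      · simpa [Function.update_of_ne hin] using h1 i ⟨hi, hin⟩
  have herase : ∏ i ∈ s.erase n, Function.update μ n κ i (t i) = ∏ i ∈ s.erase n, μ i (t i) :=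
    Finset.prod_congr rfl fun i hi => by rw [Function.update_of_ne (Finset.ne_of_mem_erase hi)]
  rw [hpre, Measure.prod_prod, Measure.infinitePi_pi μ fun i _ => ht i, ← herase]
  split_ifs with hn
  · rw [mul_comm, ← Finset.mul_prod_erase s (fun i => Function.update μ n κ i (t i)) hn,
      Function.update_self]
  · simp [Finset.erase_eq_of_notMem hn]

lemma lintegral_infinitePi_update (μ : ℕ → Measure 𝓧) [∀ i, IsProbabilityMeasure (μ i)] (n : ℕ)
    (κ : Measure 𝓧) [IsProbabilityMeasure κ] {F : (ℕ → 𝓧) → ℝ≥0∞} (hF : Measurable F) :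
    ∫⁻ ω, F ω ∂(Measure.infinitePi (Function.update μ n κ)) =
      ∫⁻ ω, ∫⁻ x, F (Function.update ω n x) ∂κ ∂(Measure.infinitePi μ) := by
  rw [← map_update_infinitePi μ n κ, lintegral_map hF (measurable_update_coord n)]
  exact lintegral_prod _ (hF.comp (measurable_update_coord n)).aemeasurable

/-- Integration over a product measure can be carried out by resampling one coordinate first. -/
lemma lintegral_update (μ : ℕ → Measure 𝓧) [∀ i, IsProbabilityMeasure (μ i)] (n : ℕ)
    {F : (ℕ → 𝓧) → ℝ≥0∞} (hF : Measurable F) :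
    ∫⁻ ω, F ω ∂(Measure.infinitePi μ) =
      ∫⁻ ω, ∫⁻ x, F (Function.update ω n x) ∂(μ n) ∂(Measure.infinitePi μ) := by
  simpa using lintegral_infinitePi_update μ n (μ n) hF

/-- Changing finitely many factors of a product law into equivalent ones preserves the null
sets; here the factors with indices below `n` are changed. -/
lemma infinitePi_ite_absolutelyContinuous {ρ κ : Measure 𝓧} [IsProbabilityMeasure ρ]
    [IsProbabilityMeasure κ] (hac : κ ≪ ρ) (n : ℕ) :
    Measure.infinitePi (fun i => if i < n then κ else ρ) ≪ Measure.infinitePi fun _ : ℕ => ρ := by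
  induction n with
  | zero => simpa using Measure.AbsolutelyContinuous.rfl
  | succ n ih =>
    have hinst : ∀ i, IsProbabilityMeasure (if i < n then κ else ρ : Measure 𝓧) := fun i => by
      split_ifs <;> infer_instance
    refine Measure.AbsolutelyContinuous.trans ?_ ih
    have hupd : (fun i => if i < n + 1 then κ else ρ) =
        Function.update (fun i => if i < n then κ else ρ) n κ := by
      ext1 i
      rcases lt_trichotomy i n with hi | rfl | hi
      · rw [Function.update_of_ne hi.ne, if_pos hi, if_pos (by omega)]
      · simp
      · rw [Function.update_of_ne hi.ne', if_neg (by omega), if_neg (by omega)]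
    rw [hupd]
    refine Measure.AbsolutelyContinuous.mk fun E hE h0 => ?_
    have hm : Measurable (E.indicator (1 : (ℕ → 𝓧) → ℝ≥0∞)) := measurable_one.indicator hE
    have hmq : Measurable fun q : (ℕ → 𝓧) × 𝓧 =>
        E.indicator (1 : (ℕ → 𝓧) → ℝ≥0∞) (Function.update q.1 n q.2) :=
      hm.comp (measurable_update_coord n)
    rw [← lintegral_indicator_one hE] at h0 ⊢
    rw [lintegral_update _ n hm, if_neg (lt_irrefl n),
      lintegral_eq_zero_iff (Measurable.lintegral_prod_right' hmq)] at h0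
    rw [lintegral_infinitePi_update _ n κ hm,
      lintegral_eq_zero_iff (Measurable.lintegral_prod_right' hmq)]
    filter_upwards [h0] with ω hω
    have hmω : Measurable fun x => E.indicator (1 : (ℕ → 𝓧) → ℝ≥0∞) (Function.update ω n x) :=
      hmq.comp measurable_prodMk_left
    simp only [Pi.zero_apply] at hω ⊢
    rw [lintegral_eq_zero_iff hmω] at hω ⊢
    exact hac.ae_le hω

/-- A process driven by the observations: the state `Z (k + 1)` is obtained from the state `Z k`,
which is determined by the first `s + k` observations, and the observation number `s + k`. -/
structure IsDriven {E : Type*} [MeasurableSpace E] (s : ℕ) (step : E → 𝓧 → E)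
    (Z : ℕ → (ℕ → 𝓧) → E) : Prop where
  measurable_step : Measurable (Function.uncurry step)
  measurable_state : ∀ k, Measurable (Z k)
  succ : ∀ k ω, Z (k + 1) ω = step (Z k ω) (ω (s + k))
  update : ∀ k ω n x, s + k ≤ n → Z k (Function.update ω n x) = Z k ω

variable {E : Type*} [MeasurableSpace E] {s : ℕ} {step : E → 𝓧 → E} {Z : ℕ → (ℕ → 𝓧) → E}
  (μ : ℕ → Measure 𝓧) [∀ i, IsProbabilityMeasure (μ i)]

/-- The Markov property of a driven process, for an event `B` that is determined by the
observations before time `s`. -/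
lemma IsDriven.setLIntegral_succ (hZ : IsDriven s step Z) {B : Set (ℕ → 𝓧)}
    (hB : MeasurableSet B) (hBs : ∀ ω n x, s ≤ n → (Function.update ω n x ∈ B ↔ ω ∈ B))
    {V : E → ℝ≥0∞} (hV : Measurable V) (k : ℕ) :
    ∫⁻ ω in B, V (Z (k + 1) ω) ∂(Measure.infinitePi μ) =
      ∫⁻ ω in B, ∫⁻ x, V (step (Z k ω) x) ∂(μ (s + k)) ∂(Measure.infinitePi μ) := by
  have hVZ : Measurable fun ω => V (Z (k + 1) ω) := hV.comp (hZ.measurable_state (k + 1))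
  rw [← lintegral_indicator hB, ← lintegral_indicator hB,
    lintegral_update μ (s + k) (hVZ.indicator hB)]
  refine lintegral_congr fun ω => ?_
  by_cases hω : ω ∈ B
  · rw [Set.indicator_of_mem hω]
    refine lintegral_congr fun x => ?_
    rw [Set.indicator_of_mem ((hBs ω (s + k) x (by omega)).2 hω), hZ.succ,
      hZ.update k ω (s + k) x le_rfl]
    simp
  · rw [Set.indicator_of_notMem hω]
    refine (lintegral_congr fun x => ?_).trans lintegral_zero
    rw [Set.indicator_of_notMem]
    rwa [hBs ω (s + k) x (by omega)]

lemma IsDriven.lintegral_succ (hZ : IsDriven s step Z) {V : E → ℝ≥0∞} (hV : Measurable V)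
    (k : ℕ) :
    ∫⁻ ω, V (Z (k + 1) ω) ∂(Measure.infinitePi μ) =
      ∫⁻ ω, ∫⁻ x, V (step (Z k ω) x) ∂(μ (s + k)) ∂(Measure.infinitePi μ) := by
  simpa using hZ.setLIntegral_succ μ MeasurableSet.univ (by simp) hV k

/-- The Foster–Lyapunov bound: if along the process the potential `V` decreases in the mean by at
least the running cost `c`, up to an allowance of `b` per step, then the total expected cost is at
most the initial potential plus the total allowance. -/
lemma IsDriven.foster_lyapunov (hZ : IsDriven s step Z) {B : Set (ℕ → 𝓧)}
    (hB : MeasurableSet B) (hBs : ∀ ω n x, s ≤ n → (Function.update ω n x ∈ B ↔ ω ∈ B))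
    {V c : E → ℝ≥0∞} (hV : Measurable V) (hc : Measurable c) (b : ℝ≥0∞)
    (hdrift : ∀ k ω, c (Z k ω) + ∫⁻ x, V (step (Z k ω) x) ∂(μ (s + k)) ≤ V (Z k ω) + b) (N : ℕ) :
    ∫⁻ ω in B, ∑ k ∈ Finset.range N, c (Z k ω) ∂(Measure.infinitePi μ) +
        ∫⁻ ω in B, V (Z N ω) ∂(Measure.infinitePi μ) ≤
      ∫⁻ ω in B, V (Z 0 ω) ∂(Measure.infinitePi μ) + N * b * Measure.infinitePi μ B := by
  have hVZ : ∀ k, Measurable fun ω => V (Z k ω) := fun k => hV.comp (hZ.measurable_state k)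
  have hcZ : ∀ k, Measurable fun ω => c (Z k ω) := fun k => hc.comp (hZ.measurable_state k)
  induction N with
  | zero => simp
  | succ N ih =>
    have hm : Measurable fun ω => ∑ k ∈ Finset.range N, c (Z k ω) :=
      Finset.measurable_sum _ fun k _ => hcZ k
    have h1 : ∫⁻ ω in B, c (Z N ω) ∂(Measure.infinitePi μ) +
        ∫⁻ ω in B, V (Z (N + 1) ω) ∂(Measure.infinitePi μ) ≤
        ∫⁻ ω in B, V (Z N ω) ∂(Measure.infinitePi μ) + b * Measure.infinitePi μ B := by
      rw [hZ.setLIntegral_succ μ hB hBs hV,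
        ← lintegral_add_left (hcZ N)]
      refine (lintegral_mono fun ω => hdrift N ω).trans_eq ?_
      rw [lintegral_add_left (hVZ N), setLIntegral_const]
    simp only [Finset.sum_range_succ]
    rw [lintegral_add_left hm, add_assoc]
    refine (add_le_add_right h1 _).trans ?_
    rw [← add_assoc]
    refine (add_le_add_left ih _).trans_eq ?_
    push_cast
    ring

end OneStep

/-! ### Expectations of extended natural numbers -/

/-- An extended natural number as the number of the integers below it. -/
lemma toENNReal_eq_tsum (t : ℕ∞) : (t : ℝ≥0∞) = ∑' n : ℕ, if (n : ℕ∞) < t then 1 else 0 := by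
  induction t using ENat.recTopCoe with
  | top => simp
  | coe a =>
    rw [tsum_eq_sum (s := Finset.range a) (by intro n hn; simpa using hn)]
    simp only [Nat.cast_lt, ENat.toENNReal_coe]
    rw [Finset.sum_congr rfl (g := fun _ => 1) fun n hn => by simpa using hn]
    simp

lemma lintegral_toENNReal_eq_tsum {Ω : Type*} [MeasurableSpace Ω] (P : Measure Ω) {t : Ω → ℕ∞}
    (ht : ∀ n : ℕ, MeasurableSet {ω | (n : ℕ∞) < t ω}) :
    ∫⁻ ω, (t ω : ℝ≥0∞) ∂P = ∑' n : ℕ, P {ω | (n : ℕ∞) < t ω} := by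
  simp only [toENNReal_eq_tsum]
  rw [lintegral_tsum fun n => (Measurable.ite (ht n) measurable_const
    measurable_const).aemeasurable]
  refine tsum_congr fun n => ?_
  rw [← lintegral_indicator_one (ht n)]
  refine lintegral_congr fun ω => ?_
  by_cases hω : (n : ℕ∞) < t ω <;> simp [hω]

/-- The excess of an extended natural number over `m`, counted by the integers from `m` on. -/
lemma toENNReal_sub_eq_tsum (t : ℕ∞) (m : ℕ) :
    (t : ℝ≥0∞) - (m : ℝ≥0∞) = ∑' n : ℕ, if ((m + n : ℕ) : ℕ∞) < t then 1 else 0 := by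
  have h : (t : ℝ≥0∞) - (m : ℝ≥0∞) = ((t - m : ℕ∞) : ℝ≥0∞) := by simp
  rw [h, toENNReal_eq_tsum]
  refine tsum_congr fun n => ?_
  congr 1
  rw [lt_tsub_iff_left]
  simp

/-! ### Densities, absolute continuity and log-likelihood ratios -/

section Densities

variable {𝓧 : Type*} [MeasurableSpace 𝓧] {ν : Measure 𝓧} {a b : 𝓧 → ℝ≥0}

lemma ae_pos_withDensity (ha : Measurable a) :
    ∀ᵐ x ∂(ν.withDensity fun x => (a x : ℝ≥0∞)), 0 < a x := by
  rw [ae_withDensity_iff ha.coe_nnreal_ennreal]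
  refine ae_of_all _ fun x hx => ?_
  simpa [pos_iff_ne_zero] using hx

/-- The relative density of two measures that are given by densities. The common reference
measure need not be σ-finite. -/
lemma withDensity_eq_withDensity_div (ha : Measurable a) (hb : Measurable b)
    (hac : (ν.withDensity fun x => (a x : ℝ≥0∞)) ≪ ν.withDensity fun x => (b x : ℝ≥0∞)) :
    (ν.withDensity fun x => (a x : ℝ≥0∞)) =
      (ν.withDensity fun x => (b x : ℝ≥0∞)).withDensity
        fun x => (a x : ℝ≥0∞) / (b x : ℝ≥0∞) := by
  have ha' := ha.coe_nnreal_ennreal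
  have hb' := hb.coe_nnreal_ennreal
  refine (withDensity_congr_ae ?_).trans (withDensity_mul _ hb' (ha'.div hb'))
  have h0 : ∀ᵐ x ∂(ν.withDensity fun x => (a x : ℝ≥0∞)), 0 < b x :=
    hac.ae_le (ae_pos_withDensity hb)
  rw [ae_withDensity_iff ha'] at h0
  filter_upwards [h0] with x hx
  simp only [Pi.mul_apply]
  by_cases hbx : b x = 0
  · have : (a x : ℝ≥0∞) = 0 := by
      by_contra h
      exact (hx h).ne' hbx
    simp [this, hbx]
  · rw [ENNReal.mul_div_cancel (by simpa using hbx) ENNReal.coe_ne_top]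

lemma rnDeriv_withDensity_eq_div (ha : Measurable a) (hb : Measurable b)
    [SigmaFinite (ν.withDensity fun x => (b x : ℝ≥0∞))]
    (hac : (ν.withDensity fun x => (a x : ℝ≥0∞)) ≪ ν.withDensity fun x => (b x : ℝ≥0∞)) :
    (ν.withDensity fun x => (a x : ℝ≥0∞)).rnDeriv (ν.withDensity fun x => (b x : ℝ≥0∞))
      =ᵐ[ν.withDensity fun x => (b x : ℝ≥0∞)] fun x => (a x : ℝ≥0∞) / (b x : ℝ≥0∞) := by
  conv_lhs => rw [withDensity_eq_withDensity_div ha hb hac]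
  exact Measure.rnDeriv_withDensity _ (ha.coe_nnreal_ennreal.div hb.coe_nnreal_ennreal)

end Densities

namespace Model

variable {𝓧 Θ : Type*} [MeasurableSpace 𝓧] (M : Model 𝓧 Θ)

instance : IsProbabilityMeasure M.P₀ := ⟨by simpa [P₀] using M.lintegral_f₀⟩

instance (θ : Θ) : IsProbabilityMeasure (M.P θ) := ⟨by simpa [P] using M.lintegral_f θ⟩

instance : IsProbabilityMeasure M.Pinf := by
  unfold Pinf
  infer_instance

instance (θ : Θ) (γ i : ℕ) :
    IsProbabilityMeasure (if i + 1 < γ then M.P₀ else M.P θ : Measure 𝓧) := by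
  split_ifs <;> infer_instance

instance (θ : Θ) (γ : ℕ) : IsProbabilityMeasure (M.Pchange θ γ) := by
  unfold Pchange
  infer_instance

lemma measurable_llr (θ : Θ) : Measurable (M.llr θ) :=
  ENNReal.measurable_log.comp
    ((M.measurable_f θ).coe_nnreal_ennreal.div M.measurable_f₀.coe_nnreal_ennreal)

lemma toReal_llr {θ : Θ} {x : 𝓧} (h : 0 < M.f θ x) (h₀ : 0 < M.f₀ x) :
    M.llr θ x = ((M.llr θ x).toReal : EReal) ∧
      (M.llr θ x).toReal = Real.log ((M.f θ x : ℝ) / M.f₀ x) := by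
  have hlog : M.llr θ x = ((Real.log ((M.f θ x : ℝ) / M.f₀ x) : ℝ) : EReal) := by
    rw [llr, ← ENNReal.coe_div h₀.ne', ENNReal.log_of_nnreal (div_pos h h₀).ne']
    simp
  rw [hlog]
  simp

variable {M} (hD : M.HasFinitePosDivergences)
include hD

lemma HasFinitePosDivergences.P_ac (θ : Θ) : M.P θ ≪ M.P₀ :=
  (klDiv_ne_top_iff.1 (hD θ).1.2.ne).1

lemma HasFinitePosDivergences.ac_P (θ : Θ) : M.P₀ ≪ M.P θ :=
  (klDiv_ne_top_iff.1 (hD θ).2.2.ne).1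

lemma HasFinitePosDivergences.P_eq_withDensity (θ : Θ) :
    M.P θ = M.P₀.withDensity fun x => (M.f θ x : ℝ≥0∞) / (M.f₀ x : ℝ≥0∞) :=
  withDensity_eq_withDensity_div (M.measurable_f θ) M.measurable_f₀ (hD.P_ac θ)

lemma HasFinitePosDivergences.ae_pos (θ : Θ) : ∀ᵐ x ∂M.P₀, 0 < M.f θ x ∧ 0 < M.f₀ x := by
  have h1 : ∀ᵐ x ∂M.P₀, 0 < M.f θ x :=
    (hD.ac_P θ).ae_le (ae_pos_withDensity (M.measurable_f θ))
  exact h1.and (ae_pos_withDensity M.measurable_f₀)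

lemma HasFinitePosDivergences.ae_coe_toReal_llr (θ : Θ) :
    ∀ᵐ x ∂M.P₀, M.llr θ x = ((M.llr θ x).toReal : EReal) := by
  filter_upwards [hD.ae_pos θ] with x hx
  exact (M.toReal_llr hx.1 hx.2).1

/-- Before the change the log-likelihood ratio has the finite negative mean `-D(f₀ ‖ f θ)`. -/
lemma HasFinitePosDivergences.integral_llr_neg (θ : Θ) :
    Integrable (fun x => (M.llr θ x).toReal) M.P₀ ∧ ∫ x, (M.llr θ x).toReal ∂M.P₀ < 0 := by
  have hac := hD.ac_P θ
  obtain ⟨-, hint⟩ := klDiv_ne_top_iff.1 (hD θ).2.2.ne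
  have : SigmaFinite (M.ν.withDensity fun x => (M.f θ x : ℝ≥0∞)) :=
    inferInstanceAs (SigmaFinite (M.P θ))
  have hrn : M.P₀.rnDeriv (M.P θ) =ᵐ[M.P₀]
      fun x => (M.f₀ x : ℝ≥0∞) / (M.f θ x : ℝ≥0∞) :=
    hac.ae_le (rnDeriv_withDensity_eq_div M.measurable_f₀ (M.measurable_f θ) hac)
  have heq : (fun x => (M.llr θ x).toReal) =ᵐ[M.P₀]
      fun x => -MeasureTheory.llr M.P₀ (M.P θ) x := by
    filter_upwards [hrn, hD.ae_pos θ] with x hx hpos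
    rw [(M.toReal_llr hpos.1 hpos.2).2, MeasureTheory.llr, hx, ← Real.log_inv]
    simp
  refine ⟨(integrable_congr heq).2 hint.neg, ?_⟩
  rw [integral_congr_ae heq, integral_neg, neg_lt_zero,
    ← toReal_klDiv_of_measure_eq hac (by simp)]
  exact ENNReal.toReal_pos (hD θ).2.1.ne' (hD θ).2.2.ne

/-- With positive probability the likelihood ratio is at least one before the change: otherwise
`f θ` would have total mass below one. -/
lemma HasFinitePosDivergences.measure_llr_nonneg_pos (θ : Θ) :
    0 < M.P₀ {x | 0 ≤ M.llr θ x} := by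
  rw [pos_iff_ne_zero]
  intro h0
  have hlt : ∀ᵐ x ∂M.P₀, (M.f θ x : ℝ≥0∞) / (M.f₀ x : ℝ≥0∞) < 1 := by
    have h1 : ∀ᵐ x ∂M.P₀, ¬ 0 ≤ M.llr θ x := by
      rw [ae_iff]
      simpa using h0
    filter_upwards [h1] with x hx
    rw [not_le, llr, ENNReal.log_lt_zero_iff] at hx
    exact hx
  have hone : ∫⁻ x, (M.f θ x : ℝ≥0∞) / (M.f₀ x : ℝ≥0∞) ∂M.P₀ = 1 := by
    have := measure_univ (μ := M.P θ)
    rwa [hD.P_eq_withDensity θ, withDensity_apply _ MeasurableSet.univ, setLIntegral_univ] at this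
  have := lintegral_strict_mono (μ := M.P₀) (NeZero.ne _) aemeasurable_const
    (by rw [hone]; simp) hlt
  simp [hone] at this

end Model

/-! ### Random walks killed below zero -/

section Walk

variable {𝓧 : Type*} [MeasurableSpace 𝓧] (ρ : Measure 𝓧) (Y : 𝓧 → EReal) (c : ℝ≥0∞)
  (g : EReal → ℝ≥0∞)

/-- The expected cost, within the first `m` steps, of a random walk with increments `Y` under `ρ`
that is started at `w` and stopped when it becomes negative: `c` per step, and `g` of the final
position. -/
noncomputable def walkCostUpTo : ℕ → EReal → ℝ≥0∞
  | 0, w => if w < 0 then g w else 0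
  | m + 1, w => if w < 0 then g w else c + ∫⁻ x, walkCostUpTo m (w + Y x) ∂ρ

/-- The expected total cost of a random walk that is stopped when it becomes negative. The final
cost is counted only on the event that the walk does become negative. -/
noncomputable def walkCost (w : EReal) : ℝ≥0∞ := ⨆ m, walkCostUpTo ρ Y c g m w

variable {ρ Y c g}

lemma walkCostUpTo_of_neg (m : ℕ) {w : EReal} (hw : w < 0) : walkCostUpTo ρ Y c g m w = g w := by
  cases m <;> simp [walkCostUpTo, hw]

lemma walkCost_of_neg {w : EReal} (hw : w < 0) : walkCost ρ Y c g w = g w := by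
  simp [walkCost, walkCostUpTo_of_neg _ hw]

lemma walkCostUpTo_succ_of_nonneg (m : ℕ) {w : EReal} (hw : 0 ≤ w) :
    walkCostUpTo ρ Y c g (m + 1) w = c + ∫⁻ x, walkCostUpTo ρ Y c g m (w + Y x) ∂ρ := by
  simp [walkCostUpTo, hw.not_gt]

lemma walkCostUpTo_le_succ (m : ℕ) (w : EReal) :
    walkCostUpTo ρ Y c g m w ≤ walkCostUpTo ρ Y c g (m + 1) w := by
  induction m generalizing w with
  | zero =>
    by_cases hw : w < 0
    · simp [walkCostUpTo_of_neg _ hw]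
    · simp [walkCostUpTo, hw]
  | succ m ih =>
    by_cases hw : w < 0
    · simp [walkCostUpTo_of_neg _ hw]
    · rw [walkCostUpTo_succ_of_nonneg _ (not_lt.1 hw), walkCostUpTo_succ_of_nonneg _ (not_lt.1 hw)]
      gcongr
      exact ih _

variable [IsProbabilityMeasure ρ]

lemma measurable_walkCostUpTo (hY : Measurable Y) (hg : Measurable g) (m : ℕ) :
    Measurable (walkCostUpTo ρ Y c g m) := by
  induction m with
  | zero => exact Measurable.ite measurableSet_Iio hg measurable_const
  | succ m ih =>
    refine Measurable.ite measurableSet_Iio hg (measurable_const.add ?_)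
    refine Measurable.lintegral_prod_right' (f := fun q : EReal × 𝓧 =>
      walkCostUpTo ρ Y c g m (q.1 + Y q.2)) ?_
    exact ih.comp (measurable_fst.add (hY.comp measurable_snd))

lemma measurable_walkCost (hY : Measurable Y) (hg : Measurable g) :
    Measurable (walkCost ρ Y c g) :=
  Measurable.iSup fun m => measurable_walkCostUpTo hY hg m

lemma walkCost_of_nonneg (hY : Measurable Y) (hg : Measurable g) {w : EReal} (hw : 0 ≤ w) :
    walkCost ρ Y c g w = c + ∫⁻ x, walkCost ρ Y c g (w + Y x) ∂ρ := by
  have hmono : ∀ w, Monotone fun m => walkCostUpTo ρ Y c g m w := fun w =>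
    monotone_nat_of_le_succ fun m => walkCostUpTo_le_succ m w
  have hmeas : ∀ m, Measurable fun x => walkCostUpTo ρ Y c g m (w + Y x) := fun m =>
    (measurable_walkCostUpTo hY hg m).comp (measurable_const.add hY)
  have h1 : walkCost ρ Y c g w = ⨆ m, walkCostUpTo ρ Y c g (m + 1) w :=
    ((hmono w).iSup_nat_add 1).symm
  rw [h1]
  simp only [walkCostUpTo_succ_of_nonneg _ hw]
  rw [← ENNReal.add_iSup]
  congr 1
  exact (lintegral_iSup hmeas fun a b hab x => hmono _ hab).symm

/-- The probability of becoming negative is a nonincreasing function of the starting point. -/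
lemma antitone_walkCostUpTo_ruin (m : ℕ) :
    Antitone (walkCostUpTo ρ Y 0 1 m) ∧ ∀ w, walkCostUpTo ρ Y 0 1 m w ≤ 1 := by
  induction m with
  | zero =>
    refine ⟨fun a b hab => ?_, fun w => ?_⟩
    · by_cases hb : b < 0
      · simp [walkCostUpTo, hb, hab.trans_lt hb]
      · simp [walkCostUpTo, hb]
    · by_cases hw : w < 0 <;> simp [walkCostUpTo, hw]
  | succ m ih =>
    have hle : ∀ w, walkCostUpTo ρ Y 0 1 (m + 1) w ≤ 1 := fun w => by
      by_cases hw : w < 0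
      · simp [walkCostUpTo, hw]
      · rw [walkCostUpTo_succ_of_nonneg _ (not_lt.1 hw), zero_add]
        exact (lintegral_mono fun x => ih.2 _).trans (by simp)
    refine ⟨fun a b hab => ?_, hle⟩
    by_cases ha : a < 0
    · rw [walkCostUpTo_of_neg _ ha]
      exact hle b
    · rw [walkCostUpTo_succ_of_nonneg _ (not_lt.1 ha),
        walkCostUpTo_succ_of_nonneg _ ((not_lt.1 ha).trans hab)]
      gcongr
      exact ih.1 (by gcongr)

lemma antitone_walkCost_ruin : Antitone (walkCost ρ Y 0 1) :=
  fun _ _ hab => iSup_mono fun m => (antitone_walkCostUpTo_ruin m).1 hab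

lemma walkCost_ruin_le_one (w : EReal) : walkCost ρ Y 0 1 w ≤ 1 :=
  iSup_le fun m => (antitone_walkCostUpTo_ruin m).2 w

/-- By the strong law of large numbers, a random walk with positive drift that starts high enough
stays nonnegative with positive probability. -/
lemma exists_walkCost_ruin_lt_one (hY : Measurable Y)
    (hfin : ∀ᵐ x ∂ρ, Y x = ((Y x).toReal : EReal)) (hint : Integrable (fun x => (Y x).toReal) ρ)
    (hpos : 0 < ∫ x, (Y x).toReal ∂ρ) : ∃ a : ℕ, walkCost ρ Y 0 1 ((a : ℝ) : EReal) < 1 := by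
  set Q : Measure (ℕ → 𝓧) := Measure.infinitePi fun _ => ρ with hQ
  set X : ℕ → (ℕ → 𝓧) → ℝ := fun i ω => (Y (ω i)).toReal with hX
  have hYr : Measurable fun x => (Y x).toReal := hY.ereal_toReal
  have hXm : ∀ i, Measurable (X i) := fun i => hYr.comp (measurable_pi_apply i)
  have heval : ∀ i, MeasurePreserving (Function.eval i) Q ρ := fun i =>
    measurePreserving_eval_infinitePi (fun _ : ℕ => ρ) i
  have hslln : ∀ᵐ ω ∂Q, Tendsto (fun n : ℕ => (∑ i ∈ Finset.range n, X i ω) / n) atTop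
      (𝓝 (∫ ω, X 0 ω ∂Q)) := by
    refine strong_law_ae_real X ((heval 0).integrable_comp_of_integrable hint) ?_ fun i => ?_
    · exact fun i j hij => (iIndepFun_infinitePi (P := fun _ : ℕ => ρ)
        (X := fun _ x => (Y x).toReal) fun _ => hYr).indepFun hij
    · refine ⟨(hXm i).aemeasurable, (hXm 0).aemeasurable, ?_⟩
      have h : ∀ i, Q.map (X i) = ρ.map fun x => (Y x).toReal := fun i => by
        rw [← (heval i).map_eq, Measure.map_map hYr (heval i).measurable]
        rfl
      rw [h, h]
  have hmean : ∫ ω, X 0 ω ∂Q = ∫ x, (Y x).toReal ∂ρ := by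
    rw [← (heval 0).map_eq, integral_map (heval 0).measurable.aemeasurable
      hYr.aestronglyMeasurable]
  have hfinQ : ∀ᵐ ω ∂Q, ∀ i, Y (ω i) = ((Y (ω i)).toReal : EReal) :=
    ae_all_iff.2 fun i => (heval i).quasiMeasurePreserving.ae hfin
  set S : ℕ → Set (ℕ → 𝓧) := fun a => {ω | ∀ n, -(a : ℝ) ≤ ∑ i ∈ Finset.range n, X i ω} with hS
  have hSm : ∀ a, MeasurableSet (S a) := fun a => by
    simp only [hS, Set.ofPred_forall]
    exact MeasurableSet.iInter fun n => measurableSet_le measurable_const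
      (Finset.measurable_sum _ fun i _ => hXm i)
  -- the partial sums tend to infinity, hence they are bounded below
  have hcover : ∀ᵐ ω ∂Q, ω ∈ ⋃ a, S a := by
    filter_upwards [hslln] with ω hω
    rw [hmean] at hω
    have hev : ∀ᶠ n : ℕ in atTop, 0 ≤ ∑ i ∈ Finset.range n, X i ω := by
      filter_upwards [hω.eventually (lt_mem_nhds hpos), eventually_gt_atTop 0] with n hn hn0
      have : (0 : ℝ) < n := by exact_mod_cast hn0
      exact ((div_pos_iff_of_pos_right this).1 hn).le
    obtain ⟨N, hN⟩ := eventually_atTop.1 hev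
    obtain ⟨a, ha⟩ := exists_nat_ge (∑ n ∈ Finset.range N, |∑ i ∈ Finset.range n, X i ω|)
    refine Set.mem_iUnion.2 ⟨a, fun n => ?_⟩
    rcases le_or_gt N n with hn | hn
    · exact (neg_nonpos.2 (Nat.cast_nonneg a)).trans (hN n hn)
    · have := Finset.single_le_sum (f := fun n => |∑ i ∈ Finset.range n, X i ω|)
        (fun _ _ => abs_nonneg _) (Finset.mem_range.2 hn)
      linarith [neg_abs_le (∑ i ∈ Finset.range n, X i ω)]
  obtain ⟨a, ha⟩ : ∃ a, Q (S a) ≠ 0 := by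
    by_contra! h
    have h0 : Q (⋃ a, S a) = 0 := measure_iUnion_null h
    have h1 : Q (⋃ a, S a)ᶜ = 0 := hcover
    have := prob_add_prob_compl (μ := Q) (MeasurableSet.iUnion hSm)
    rw [h0, h1, add_zero] at this
    exact zero_ne_one this
  -- the walk, frozen when it becomes negative
  let step : EReal → 𝓧 → EReal := fun z x => if z < 0 then z else z + Y x
  let Z : ℕ → (ℕ → 𝓧) → EReal := fun k ω =>
    Nat.rec ((a : ℝ) : EReal) (fun i z => step z (ω i)) k
  have hstep : Measurable (Function.uncurry step) :=
    Measurable.ite (measurable_fst measurableSet_Iio) measurable_fst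
      (measurable_fst.add (hY.comp measurable_snd))
  have hZ : IsDriven 0 step Z := by
    refine ⟨hstep, fun k => ?_, fun k ω => by simp [Z], fun k ω n x hk => ?_⟩
    · induction k with
      | zero => exact measurable_const
      | succ k ih => exact hstep.comp (ih.prodMk (measurable_pi_apply k))
    · induction k with
      | zero => rfl
      | succ k ih =>
        change step (Z k _) _ = step (Z k ω) (ω k)
        rw [ih (by omega), Function.update_of_ne (by omega)]
  have hrec : ∀ m k, ∫⁻ ω, walkCostUpTo ρ Y 0 1 m (Z k ω) ∂Q =
      ∫⁻ ω, walkCostUpTo ρ Y 0 1 0 (Z (k + m) ω) ∂Q := by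
    intro m
    induction m with
    | zero => intro k; rfl
    | succ m ih =>
      intro k
      rw [show k + (m + 1) = (k + 1) + m by omega, ← ih,
        hZ.lintegral_succ (fun _ => ρ) (measurable_walkCostUpTo hY measurable_one m)]
      refine lintegral_congr fun ω => ?_
      rcases lt_or_ge (Z k ω) 0 with hz | hz
      · simp [step, hz, walkCostUpTo_of_neg _ hz]
      · simp [step, hz.not_gt, walkCostUpTo]
  refine ⟨a, lt_of_le_of_lt (iSup_le fun m => ?_) (ENNReal.sub_lt_self ENNReal.one_ne_top
    one_ne_zero ha : 1 - Q (S a) < 1)⟩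
  have h1 : walkCostUpTo ρ Y 0 1 m ((a : ℝ) : EReal) =
      ∫⁻ ω, walkCostUpTo ρ Y 0 1 m (Z 0 ω) ∂Q := by simp [Z]
  rw [h1, hrec, zero_add, ← prob_compl_eq_one_sub (hSm a), ← lintegral_indicator_one (hSm a).compl]
  refine lintegral_mono_ae ?_
  filter_upwards [hfinQ] with ω hω
  by_cases hωS : ω ∈ S a
  · have hZr : Z m ω = ((a + ∑ i ∈ Finset.range m, X i ω : ℝ) : EReal) := by
      clear h1
      induction m with
      | zero => simp [Z]
      | succ m ih =>
        change step (Z m ω) (ω m) = _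
        have h0 : ¬ Z m ω < 0 := by
          rw [ih, not_lt]
          exact_mod_cast (by linarith [hωS m])
        rw [show step (Z m ω) (ω m) = Z m ω + Y (ω m) by simp [step, h0], ih, hω m,
          Finset.sum_range_succ, ← EReal.coe_add, add_assoc]
    have h0 : ¬ Z m ω < 0 := by
      rw [hZr, not_lt]
      exact_mod_cast (by linarith [hωS m])
    simp [walkCostUpTo, h0]
  · rcases lt_or_ge (Z m ω) 0 with h0 | h0
    · simp [walkCostUpTo, h0, hωS]
    · simp [walkCostUpTo, h0.not_gt]

/-- A random walk with positive drift that starts at zero stays nonnegative with positive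
probability: a run of large increments lifts it to a level from which it may stay nonnegative. -/
lemma walkCost_ruin_zero_lt_one (hY : Measurable Y)
    (hfin : ∀ᵐ x ∂ρ, Y x = ((Y x).toReal : EReal)) (hint : Integrable (fun x => (Y x).toReal) ρ)
    (hpos : 0 < ∫ x, (Y x).toReal ∂ρ) : walkCost ρ Y 0 1 0 < 1 := by
  set d := ∫ x, (Y x).toReal ∂ρ with hd
  obtain ⟨a, ha⟩ := exists_walkCost_ruin_lt_one hY hfin hint hpos
  have hdown : ∀ w : ℝ, 0 ≤ w → walkCost ρ Y 0 1 ((w + d : ℝ) : EReal) < 1 →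
      walkCost ρ Y 0 1 (w : EReal) < 1 := by
    intro w hw hlt
    rw [walkCost_of_nonneg hY measurable_one (by exact_mod_cast hw), zero_add]
    have key := lintegral_strict_mono_of_ae_le_of_ae_lt_on (μ := ρ) (g := fun _ => (1 : ℝ≥0∞))
      (f := fun x => walkCost ρ Y 0 1 ((w : EReal) + Y x)) (s := {x | d ≤ (Y x).toReal})
      aemeasurable_const
      (((lintegral_mono fun x => walkCost_ruin_le_one _).trans_lt (by simp :
        ∫⁻ _, (1 : ℝ≥0∞) ∂ρ < ⊤)).ne)
      (ae_of_all _ fun x => walkCost_ruin_le_one _) (measure_integral_le_pos hint).ne' ?_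
    · simpa using key
    · filter_upwards [hfin] with x hx hxd
      refine lt_of_le_of_lt (antitone_walkCost_ruin ?_) hlt
      rw [hx, ← EReal.coe_add]
      exact_mod_cast add_le_add_right hxd w
  obtain ⟨k, hk⟩ := exists_nat_ge ((a : ℝ) / d)
  have hka : (a : ℝ) ≤ k * d := (div_le_iff₀ hpos).1 hk
  have htop : walkCost ρ Y 0 1 ((k * d : ℝ) : EReal) < 1 :=
    lt_of_le_of_lt (antitone_walkCost_ruin (by exact_mod_cast hka)) ha
  clear hk hka
  induction k with
  | zero => simpa using htop
  | succ k ih =>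
    refine ih (hdown _ (by positivity) ?_)
    convert htop using 3
    push_cast
    ring

/-- A random walk with negative drift becomes negative within a finite expected time. Truncating
the increments from below keeps the drift negative and makes the potential
`w ↦ (w + b) / drift` available. -/
lemma walkCost_time_lt_top
    (hfin : ∀ᵐ x ∂ρ, Y x = ((Y x).toReal : EReal)) (hint : Integrable (fun x => (Y x).toReal) ρ)
    (hneg : ∫ x, (Y x).toReal ∂ρ < 0) : walkCost ρ Y 1 0 0 < ∞ := by
  obtain ⟨b, hb⟩ : ∃ b : ℕ, ∫ x, max (Y x).toReal (-(b : ℝ)) ∂ρ < 0 := by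
    have hlim : Tendsto (fun b : ℕ => ∫ x, max (Y x).toReal (-(b : ℝ)) ∂ρ) atTop
        (𝓝 (∫ x, (Y x).toReal ∂ρ)) := by
      refine tendsto_integral_of_dominated_convergence (fun x => |(Y x).toReal|)
        (fun b => (hint.aestronglyMeasurable.sup aestronglyMeasurable_const)) hint.abs
        (fun b => ae_of_all _ fun x => ?_) (ae_of_all _ fun x => ?_)
      · rw [Real.norm_eq_abs, abs_le]
        have hb : (0 : ℝ) ≤ b := Nat.cast_nonneg b
        exact ⟨(neg_abs_le _).trans (le_max_left _ _),
          max_le (le_abs_self _) (by linarith [abs_nonneg (Y x).toReal])⟩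
      · refine tendsto_const_nhds.congr' ?_
        obtain ⟨N, hN⟩ := exists_nat_ge (-(Y x).toReal)
        filter_upwards [eventually_ge_atTop N] with b hb
        have : (N : ℝ) ≤ b := by exact_mod_cast hb
        rw [max_eq_left (by linarith)]
    exact (hlim.eventually (gt_mem_nhds hneg)).exists
  set m := -∫ x, max (Y x).toReal (-(b : ℝ)) ∂ρ with hm
  have hmpos : 0 < m := by linarith
  have hint' : Integrable (fun x => max (Y x).toReal (-(b : ℝ))) ρ :=
    hint.sup (integrable_const _)
  have hbound : ∀ (n : ℕ) (w : ℝ),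
      walkCostUpTo ρ Y 1 0 n (w : EReal) ≤ ENNReal.ofReal ((w + b) / m) := by
    intro n
    induction n with
    | zero => intro w; by_cases hw : (w : EReal) < 0 <;> simp [walkCostUpTo, hw]
    | succ n ih =>
      intro w
      by_cases hw : (w : EReal) < 0
      · simp [walkCostUpTo, hw]
      have hw0 : 0 ≤ w := by exact_mod_cast not_lt.1 hw
      rw [walkCostUpTo_succ_of_nonneg _ (not_lt.1 hw)]
      have hpt : ∀ᵐ x ∂ρ, walkCostUpTo ρ Y 1 0 n ((w : EReal) + Y x) ≤
          ENNReal.ofReal ((w + b + max (Y x).toReal (-(b : ℝ))) / m) := by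
        filter_upwards [hfin] with x hx
        rw [hx, ← EReal.coe_add]
        refine (ih _).trans (ENNReal.ofReal_le_ofReal ?_)
        have := le_max_left (Y x).toReal (-(b : ℝ))
        rw [EReal.toReal_coe]
        refine div_le_div_of_nonneg_right ?_ hmpos.le
        linarith
      refine (add_le_add_right (lintegral_mono_ae hpt) 1).trans ?_
      rw [← ofReal_integral_eq_lintegral_ofReal]
      · have hval : ∫ x, (w + b + max (Y x).toReal (-(b : ℝ))) / m ∂ρ = (w + b) / m - 1 := by
          rw [integral_div, integral_add (integrable_const _) hint', integral_const,
            probReal_univ, one_smul,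
            show ∫ x, max (Y x).toReal (-(b : ℝ)) ∂ρ = -m by rw [hm]; ring]
          field_simp
          ring
        have hnn : 0 ≤ (w + b) / m - 1 := by
          rw [← hval]
          refine integral_nonneg fun x => div_nonneg ?_ hmpos.le
          linarith [le_max_right (Y x).toReal (-(b : ℝ))]
        rw [hval, ← ENNReal.ofReal_one, ← ENNReal.ofReal_add zero_le_one hnn]
        exact ENNReal.ofReal_le_ofReal (by linarith)
      · exact ((integrable_const _).add hint').div_const _
      · refine ae_of_all _ fun x => div_nonneg ?_ hmpos.le
        linarith [le_max_right (Y x).toReal (-(b : ℝ))]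
  refine (iSup_le fun n => ?_).trans_lt (ENNReal.ofReal_lt_top (r := (0 + b) / m))
  exact_mod_cast hbound n 0

/-- A random walk which may step below zero at once has an expected final cost strictly below any
finite constant that strictly bounds the cost of the negative positions. -/
lemma walkCost_final_lt (hY : Measurable Y) (hg : Measurable g)
    {H : ℝ≥0∞} (hH : H ≠ ∞) (hgH : ∀ w < 0, g w < H)
    (hneg : ρ {x | Y x < 0} ≠ 0) : walkCost ρ Y 0 g 0 < H := by
  have hle : ∀ m w, walkCostUpTo ρ Y 0 g m w ≤ H := by
    intro m
    induction m with
    | zero =>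
      intro w
      by_cases hw : w < 0
      · simpa [walkCostUpTo, hw] using (hgH w hw).le
      · simp [walkCostUpTo, hw]
    | succ m ih =>
      intro w
      by_cases hw : w < 0
      · simpa [walkCostUpTo, hw] using (hgH w hw).le
      · rw [walkCostUpTo_succ_of_nonneg _ (not_lt.1 hw), zero_add]
        exact (lintegral_mono fun x => ih _).trans (by simp)
  have hle' : ∀ w, walkCost ρ Y 0 g w ≤ H := fun w => iSup_le fun m => hle m w
  rw [walkCost_of_nonneg hY hg le_rfl, zero_add]
  have key := lintegral_strict_mono_of_ae_le_of_ae_lt_on (μ := ρ) (g := fun _ => H)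
    (f := fun x => walkCost ρ Y 0 g (0 + Y x)) (s := {x | Y x < 0}) aemeasurable_const
    (((lintegral_mono fun x => hle' _).trans_lt (by simpa using hH.lt_top :
      ∫⁻ _, H ∂ρ < ⊤)).ne)
    (ae_of_all _ fun x => hle' _) hneg ?_
  · simpa using key
  · refine ae_of_all _ fun x hx => ?_
    simp only [zero_add]
    rw [walkCost_of_neg hx]
    exact hgH _ hx

end Walk

/-! ### Records and observation controls -/

section Record

variable {𝓧 : Type*}

lemma record_congr (φ : Control 𝓧) {n : ℕ} {ω ω' : ℕ → 𝓧} (h : ∀ i < n, ω i = ω' i) :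
    record φ n ω = record φ n ω' := by
  induction n with
  | zero => exact funext fun i => i.elim0
  | succ n ih => simp only [record, ih fun i hi => h i (by omega), h n (by omega)]

lemma record_update (φ : Control 𝓧) {n m : ℕ} (hnm : n ≤ m) (ω : ℕ → 𝓧) (x : 𝓧) :
    record φ n (Function.update ω m x) = record φ n ω :=
  record_congr φ fun i hi => Function.update_of_ne (by omega) _ _

lemma used_update (φ : Control 𝓧) {n m : ℕ} (hnm : n ≤ m) (ω : ℕ → 𝓧) (x : 𝓧) :
    used φ n (Function.update ω m x) = used φ n ω := by
  simp only [used, record_update φ hnm]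

lemma init_record_succ (φ : Control 𝓧) (n : ℕ) (ω : ℕ → 𝓧) :
    Fin.init (α := fun _ => Obs 𝓧) (record φ (n + 1) ω) = record φ n ω := by
  simp [record]

lemma record_succ_last (φ : Control 𝓧) (n : ℕ) (ω : ℕ → 𝓧) :
    record φ (n + 1) ω (Fin.last n) = if used φ n ω then Sum.inl (ω n) else Sum.inr () := by
  simp only [record, Fin.snoc_last, used]
  rfl

variable [MeasurableSpace 𝓧]

/-- Functions of a record entry that are defined by cases are measurable. -/
lemma measurable_obs_elim {A E : Type*} [MeasurableSpace A] [MeasurableSpace E] {f : A × 𝓧 → E}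
    {g : A → E} (hf : Measurable f) (hg : Measurable g) :
    Measurable fun q : A × Obs 𝓧 => Sum.elim (fun x => f (q.1, x)) (fun _ => g q.1) q.2 := by
  have h : Measurable (Sum.elim f fun q : A × Unit => g q.1) :=
    measurable_fun_sum hf (hg.comp measurable_fst)
  convert h.comp (MeasurableEquiv.prodSumDistrib A 𝓧 Unit).measurable using 1
  ext ⟨a, o⟩
  cases o <;> rfl

lemma measurable_init_obs (n : ℕ) :
    Measurable fun I : Fin (n + 1) → Obs 𝓧 => Fin.init (α := fun _ => Obs 𝓧) I :=
  measurable_pi_iff.2 fun i => measurable_pi_apply i.castSucc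

lemma measurable_record {φ : Control 𝓧} (hφ : ∀ n, Measurable (φ n)) (n : ℕ) :
    Measurable (record φ n) := by
  induction n with
  | zero => exact measurable_pi_iff.2 fun i => i.elim0
  | succ n ih =>
    refine measurable_pi_iff.2 fun i => ?_
    refine Fin.lastCases ?_ (fun j => ?_) i
    · simp only [record_succ_last]
      exact Measurable.ite (((hφ n).comp ih) (measurableSet_singleton true))
        (measurable_inl.comp (measurable_pi_apply n)) measurable_const
    · simpa [record] using (measurable_pi_iff.1 ih j)

lemma infoSigma_le {φ : Control 𝓧} (hφ : ∀ n, Measurable (φ n)) (n : ℕ) :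
    infoSigma φ n ≤ MeasurableSpace.pi :=
  (measurable_record hφ n).comap_le

lemma infoSigma_mono (φ : Control 𝓧) (n : ℕ) : infoSigma φ n ≤ infoSigma φ (n + 1) := by
  rw [infoSigma, ← measurable_iff_comap_le]
  have h : record φ n = (fun I => Fin.init (α := fun _ => Obs 𝓧) I) ∘ record φ (n + 1) :=
    funext fun ω => (init_record_succ φ n ω).symm
  rw [h]
  exact (measurable_init_obs n).comp (comap_measurable _)

/-- The events determined by the information at time `n` do not depend on later observations. -/
lemma update_mem_iff_of_infoSigma {φ : Control 𝓧} {n : ℕ} {B : Set (ℕ → 𝓧)}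
    (hB : MeasurableSet[infoSigma φ n] B) (ω : ℕ → 𝓧) (m : ℕ) (x : 𝓧) (hnm : n ≤ m) :
    Function.update ω m x ∈ B ↔ ω ∈ B := by
  obtain ⟨C, -, rfl⟩ := hB
  simp only [Set.mem_preimage, record_update φ hnm]

end Record

namespace Model

variable {𝓧 Θ : Type*} [MeasurableSpace 𝓧] (M : Model 𝓧 Θ) (θs : Θ) (μ h : ℝ)

/-- One step of the DECuSum statistic, driven by the next observation. -/
noncomputable def deStep (w : EReal) (x : 𝓧) : EReal :=
  if 0 ≤ w then max (w + M.llr θs x) ((-h : ℝ) : EReal) else min (w + (μ : EReal)) 0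

lemma measurable_deStep : Measurable (Function.uncurry (M.deStep θs μ h)) :=
  Measurable.ite (measurable_fst measurableSet_Ici)
    ((measurable_fst.add ((M.measurable_llr θs).comp measurable_snd)).max measurable_const)
    ((measurable_fst.add measurable_const).min measurable_const)

lemma measurable_W (n : ℕ) : Measurable (M.W θs μ h n) := by
  induction n with
  | zero => exact measurable_const
  | succ n ih =>
    have hf : Measurable fun q : (Fin n → Obs 𝓧) × 𝓧 =>
        max (M.W θs μ h n q.1 + M.llr θs q.2) ((-h : ℝ) : EReal) :=
      ((ih.comp measurable_fst).add ((M.measurable_llr θs).comp measurable_snd)).max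
        measurable_const
    have hg : Measurable fun I : Fin n → Obs 𝓧 => min (M.W θs μ h n I + (μ : EReal)) 0 :=
      (ih.add measurable_const).min measurable_const
    convert (measurable_obs_elim hf hg).comp
      ((measurable_init_obs n).prodMk (measurable_pi_apply (Fin.last n))) using 1
    ext I
    simp only [W, Function.comp_apply]
    cases I (Fin.last n) <;> rfl

lemma measurable_deControl (n : ℕ) : Measurable (M.deControl θs μ h n) := by
  refine measurable_to_bool ?_
  have hset : M.deControl θs μ h n ⁻¹' {true} = M.W θs μ h n ⁻¹' Set.Ici 0 := by
    ext I
    simp [deControl]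
  rw [hset]
  exact M.measurable_W θs μ h n measurableSet_Ici

/-- The DECuSum statistic along a sample path. -/
noncomputable def pathW (n : ℕ) (ω : ℕ → 𝓧) : EReal :=
  M.W θs μ h n (record (M.deControl θs μ h) n ω)

lemma used_deControl_iff (n : ℕ) (ω : ℕ → 𝓧) :
    used (M.deControl θs μ h) n ω = true ↔ 0 ≤ M.pathW θs μ h n ω := by
  simp [used, deControl, pathW]

lemma pathW_succ (n : ℕ) (ω : ℕ → 𝓧) :
    M.pathW θs μ h (n + 1) ω = M.deStep θs μ h (M.pathW θs μ h n ω) (ω n) := by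
  have hu := M.used_deControl_iff θs μ h n ω
  rw [pathW, W, init_record_succ, record_succ_last, deStep]
  by_cases h0 : 0 ≤ M.pathW θs μ h n ω
  · rw [if_pos (hu.2 h0), if_pos h0]
    rfl
  · rw [if_neg (fun hc => h0 (hu.1 hc)), if_neg h0]
    rfl

lemma isDriven_pathW (s : ℕ) :
    IsDriven s (M.deStep θs μ h) fun k => M.pathW θs μ h (s + k) where
  measurable_step := M.measurable_deStep θs μ h
  measurable_state k := (M.measurable_W θs μ h _).comp
    (measurable_record (M.measurable_deControl θs μ h) _)
  succ k ω := M.pathW_succ θs μ h (s + k) ω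
  update k ω n x hn := by simp only [pathW, record_update _ hn]

variable {μ h}

lemma neg_le_pathW (hμ : 0 ≤ μ) (hh : 0 ≤ h) (n : ℕ) (ω : ℕ → 𝓧) :
    ((-h : ℝ) : EReal) ≤ M.pathW θs μ h n ω := by
  have h0 : ((-h : ℝ) : EReal) ≤ 0 := by exact_mod_cast neg_nonpos.2 hh
  induction n with
  | zero => exact h0
  | succ n ih =>
    rw [pathW_succ, deStep]
    split_ifs
    · exact le_max_right _ _
    · refine le_min (ih.trans ?_) h0
      exact le_add_of_nonneg_right (by exact_mod_cast hμ)

/-- A negative value of the DECuSum statistic is a real number in `[-h, 0)`. -/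
lemma exists_coe_pathW (hμ : 0 ≤ μ) (hh : 0 ≤ h) {n : ℕ} {ω : ℕ → 𝓧}
    (hw : M.pathW θs μ h n ω < 0) :
    ∃ u : ℝ, M.pathW θs μ h n ω = (u : EReal) ∧ -h ≤ u ∧ u < 0 := by
  have hle := M.neg_le_pathW θs hμ hh n ω
  have hbot : M.pathW θs μ h n ω ≠ ⊥ := fun hb => by
    rw [hb] at hle
    exact absurd hle (by simp)
  have htop : M.pathW θs μ h n ω ≠ ⊤ := (hw.trans EReal.zero_lt_top).ne
  lift M.pathW θs μ h n ω to ℝ using ⟨htop, hbot⟩ with u hu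
  exact ⟨u, rfl, by exact_mod_cast hle, by exact_mod_cast hw⟩

/-! ### The duty cycle of the DECuSum control -/

lemma sum_used_eq (n : ℕ) (ω : ℕ → 𝓧) :
    (∑ k ∈ Finset.range n, if used (M.deControl θs μ h) k ω then (1 : ℝ≥0∞) else 0) =
      ∑ k ∈ Finset.range n, if 0 ≤ M.pathW θs μ h (0 + k) ω then (1 : ℝ≥0∞) else 0 := by
  refine Finset.sum_congr rfl fun k _ => ?_
  simp only [used_deControl_iff, zero_add]

lemma PDC_le_of_lintegral_le {φ : Control 𝓧} {β C : ℝ≥0∞} (hC : C ≠ ∞)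
    (hle : ∀ n : ℕ, ∫⁻ ω, (∑ k ∈ Finset.range n, if used φ k ω then (1 : ℝ≥0∞) else 0) ∂M.Pinf ≤
      C + n * β) : M.PDC φ ≤ β := by
  have hlim : Tendsto (fun γ : ℕ => C / (γ : ℝ≥0∞) + β) atTop (𝓝 β) := by
    simpa using (ENNReal.Tendsto.const_div ENNReal.tendsto_nat_nhds_top (Or.inr hC)).add
      (tendsto_const_nhds (x := β))
  rw [PDC, ← hlim.limsup_eq]
  refine limsup_le_limsup ?_
  filter_upwards [eventually_gt_atTop 0] with γ hγ
  have hγ0 : (γ : ℝ≥0∞) ≠ 0 := by exact_mod_cast hγ.ne'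
  simp only [div_eq_mul_inv]
  rw [lintegral_mul_const' _ _ (ENNReal.inv_ne_top.2 hγ0)]
  refine (mul_le_mul_left (hle (γ - 1)) _).trans ?_
  rw [add_mul]
  refine add_le_add_right ?_ _
  calc ((γ - 1 : ℕ) : ℝ≥0∞) * β * (γ : ℝ≥0∞)⁻¹ ≤ (γ : ℝ≥0∞) * β * (γ : ℝ≥0∞)⁻¹ := by
        gcongr
        omega
    _ = β := by
        rw [mul_right_comm, ENNReal.mul_inv_cancel hγ0 (ENNReal.natCast_ne_top γ), one_mul]

variable {M} in
/-- For small `μ` the duty cycle is small: an excursion of the statistic above zero has finite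
mean length, and the excursion below zero that follows it takes a time of order `1 / μ`. -/
lemma HasFinitePosDivergences.exists_PDC_le (hD : M.HasFinitePosDivergences) {β : ℝ} (hβ : 0 < β)
    {h : ℝ} (hh : 0 < h) : ∃ μ₀ : ℝ, 0 < μ₀ ∧ ∀ μ : ℝ, 0 < μ → μ ≤ μ₀ →
      M.PDC (M.deControl θs μ h) ≤ ENNReal.ofReal β := by
  obtain ⟨hint, hneg⟩ := hD.integral_llr_neg θs
  have hfin := hD.ae_coe_toReal_llr θs
  have hY := M.measurable_llr θs
  -- the distance of a negative position to `-h`, in units of skipped observations times `μ`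
  let g : EReal → ℝ≥0∞ := fun w => (w + (h : EReal)).toENNReal
  have hg : Measurable g := (measurable_id.add measurable_const).ereal_toENNReal
  have hgcoe : ∀ u : ℝ, g u = ENNReal.ofReal (u + h) := fun u => by
    simp only [g, ← EReal.coe_add, EReal.toENNReal_of_ne_top (EReal.coe_ne_top _),
      EReal.toReal_coe]
  set T := walkCost M.P₀ (M.llr θs) 1 0 with hTdef
  set v := walkCost M.P₀ (M.llr θs) 0 g with hvdef
  have hTm : Measurable T := measurable_walkCost hY measurable_zero
  have hvm : Measurable v := measurable_walkCost hY hg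
  have hT0 : T 0 < ∞ := walkCost_time_lt_top hfin hint hneg
  have hv0 : v 0 < ENNReal.ofReal h := by
    refine walkCost_final_lt hY hg ENNReal.ofReal_ne_top (fun w hw => ?_) ?_
    · induction w with
      | bot => simpa [g] using hh
      | top => exact absurd hw (by simp)
      | coe u =>
        rw [hgcoe, ENNReal.ofReal_lt_ofReal_iff hh]
        have : u < 0 := by exact_mod_cast hw
        linarith
    · intro hzero
      refine (measure_le_integral_pos hint).ne' (measure_mono_null_ae ?_ hzero)
      filter_upwards [hfin] with x hx hle
      show M.llr θs x < 0
      rw [hx]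
      exact_mod_cast (lt_of_le_of_lt hle hneg)
  obtain ⟨t, ht⟩ : ∃ t : ℝ, 0 ≤ t ∧ T 0 = ENNReal.ofReal t :=
    ⟨(T 0).toReal, ENNReal.toReal_nonneg, (ENNReal.ofReal_toReal hT0.ne).symm⟩
  obtain ⟨y, hy⟩ : ∃ y : ℝ, 0 ≤ y ∧ v 0 = ENNReal.ofReal y :=
    ⟨(v 0).toReal, ENNReal.toReal_nonneg, (ENNReal.ofReal_toReal (hv0.trans_le le_top).ne).symm⟩
  have hyh : y < h := by
    rw [hy.2, ENNReal.ofReal_lt_ofReal_iff hh] at hv0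
    exact hv0
  refine ⟨β * (h - y) / (t + 1), by have := ht.1; have := sub_pos.2 hyh; positivity,
    fun μ hμ hμ₀ => ?_⟩
  have ht1 : 0 < t + 1 := by linarith [ht.1]
  have hμt : μ * (t + 1) ≤ β * (h - y) := (le_div_iff₀ ht1).1 hμ₀
  set κ := ENNReal.ofReal (β / μ) with hκ
  have hκnn : 0 ≤ β / μ := by positivity
  let V : EReal → ℝ≥0∞ := fun w => T w + κ * v w
  have hV : Measurable V := hTm.add (measurable_const.mul hvm)
  have hVneg : ∀ u : ℝ, u < 0 → V u = ENNReal.ofReal (β / μ * (u + h)) := fun u hu => by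
    have hu' : (u : EReal) < 0 := by exact_mod_cast hu
    simp only [V, hTdef, hvdef, walkCost_of_neg hu', hgcoe]
    rw [ENNReal.ofReal_mul hκnn]
    simp [hκ]
  have hV0 : V 0 ≤ ENNReal.ofReal (β / μ * h) := by
    simp only [V]
    rw [ht.2, hy.2, hκ, ← ENNReal.ofReal_mul hκnn, ← ENNReal.ofReal_add ht.1
      (mul_nonneg hκnn hy.1)]
    refine ENNReal.ofReal_le_ofReal ?_
    have : t ≤ β / μ * (h - y) := by
      rw [div_mul_eq_mul_div, le_div_iff₀ hμ]
      nlinarith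
    linarith
  have hdrift : ∀ (k : ℕ) (ω : ℕ → 𝓧),
      (if 0 ≤ M.pathW θs μ h (0 + k) ω then (1 : ℝ≥0∞) else 0) +
        ∫⁻ x, V (M.deStep θs μ h (M.pathW θs μ h (0 + k) ω) x) ∂M.P₀ ≤
        V (M.pathW θs μ h (0 + k) ω) + ENNReal.ofReal β := by
    intro k ω
    rcases lt_or_ge (M.pathW θs μ h (0 + k) ω) 0 with hw | hw
    · obtain ⟨u, hu, hhu, hu0⟩ := M.exists_coe_pathW θs hμ.le hh.le hw
      rw [hu]
      have hu0' : ¬ (0 : EReal) ≤ u := by exact_mod_cast not_le.2 hu0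
      simp only [deStep, hu0', if_false, zero_add, lintegral_const, measure_univ, mul_one]
      rw [hVneg u hu0, ← ENNReal.ofReal_add (mul_nonneg hκnn (by linarith)) hβ.le]
      have hid : β / μ * (u + h) + β = β / μ * (u + μ + h) := by field_simp; ring
      rw [hid, ← EReal.coe_add]
      rcases lt_or_ge (u + μ) 0 with hlt | hge
      · rw [min_eq_left (by exact_mod_cast hlt.le), hVneg _ hlt]
      · rw [min_eq_right (by exact_mod_cast hge)]
        refine hV0.trans (ENNReal.ofReal_le_ofReal ?_)
        gcongr
        linarith
    · generalize M.pathW θs μ h (0 + k) ω = w at hw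
      refine le_trans (le_of_eq ?_) le_self_add
      simp only [hw, if_true, deStep, V]
      have hTw : T w = 1 + ∫⁻ x, T (w + M.llr θs x) ∂M.P₀ :=
        walkCost_of_nonneg hY measurable_zero hw
      have hvw : v w = 0 + ∫⁻ x, v (w + M.llr θs x) ∂M.P₀ := walkCost_of_nonneg hY hg hw
      have hadd : Measurable fun x => w + M.llr θs x := measurable_const.add hY
      have hTx : Measurable fun x => T (w + M.llr θs x) := hTm.comp hadd
      have hvx : Measurable fun x => v (w + M.llr θs x) := hvm.comp hadd
      rw [hTw, hvw, zero_add, add_assoc, ← lintegral_const_mul _ hvx, ← lintegral_add_left hTx]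
      congr 1
      refine lintegral_congr fun x => ?_
      -- below `-h` the truncation of the statistic does not change the potential
      rcases le_or_gt ((-h : ℝ) : EReal) (w + M.llr θs x) with hge | hlt
      · rw [max_eq_left hge]
      · have hh0 : (((-h : ℝ) : EReal)) < 0 := by exact_mod_cast neg_lt_zero.2 hh
        rw [max_eq_right hlt.le]
        simp only [hTdef, hvdef, walkCost_of_neg hh0, walkCost_of_neg (hlt.trans hh0)]
        have h1 : g ((-h : ℝ) : EReal) = 0 := by rw [hgcoe]; simp
        have h2 : g (w + M.llr θs x) = 0 := by
          have : g (w + M.llr θs x) ≤ g ((-h : ℝ) : EReal) :=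
            EReal.toENNReal_le_toENNReal (add_le_add_left hlt.le _)
          exact le_antisymm (this.trans_eq h1) bot_le
        rw [h1, h2]
        simp
  refine M.PDC_le_of_lintegral_le (C := V 0)
    (hV0.trans_lt ENNReal.ofReal_lt_top).ne fun n => ?_
  have hlya := (M.isDriven_pathW θs μ h 0).foster_lyapunov (fun _ => M.P₀) MeasurableSet.univ
    (by simp) hV (c := fun w => if 0 ≤ w then (1 : ℝ≥0∞) else 0)
    (Measurable.ite measurableSet_Ici measurable_const measurable_const) _ hdrift n
  have h1 := le_self_add.trans hlya
  simp only [setLIntegral_univ, measure_univ, mul_one] at h1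
  have hW0 : ∀ ω, M.pathW θs μ h (0 + 0) ω = 0 := fun ω => rfl
  simp only [hW0, lintegral_const, measure_univ, mul_one] at h1
  simp only [sum_used_eq]
  exact h1

end Model

namespace Model

variable {𝓧 Θ : Type*} [MeasurableSpace 𝓧] {M : Model 𝓧 Θ}

/-! ### The number of skipped observations after the change -/

/-- After the change the expected number of skipped observations is bounded, uniformly in the state
at the change: an excursion of the DECuSum statistic below zero takes at most `1 + h / μ` skipped
observations, and after each of them the statistic, whose drift is positive, stays nonnegative
forever with a fixed positive probability. The bound is expressed by a bounded potential `V` which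
decreases in the mean by at least one when an observation is skipped. -/
lemma HasFinitePosDivergences.exists_skip_potential (hD : M.HasFinitePosDivergences) {θs : Θ}
    (hθs : M.IsLeastFavorable θs) {μ h : ℝ} (hμ : 0 < μ) (hh : 0 ≤ h) (θ : Θ) :
    ∃ (V : EReal → ℝ≥0∞) (C : ℝ≥0∞), Measurable V ∧ C ≠ ∞ ∧
      ∀ n ω, V (M.pathW θs μ h n ω) ≤ C ∧
        (if 0 ≤ M.pathW θs μ h n ω then 0 else 1) +
          ∫⁻ x, V (M.deStep θs μ h (M.pathW θs μ h n ω) x) ∂(M.P θ) ≤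
            V (M.pathW θs μ h n ω) := by
  have hint : Integrable (fun x => (M.llr θs x).toReal) (M.P θ) := by
    by_contra hc
    have := hθs θ
    rw [integral_undef hc] at this
    exact lt_irrefl _ this
  have hfin : ∀ᵐ x ∂(M.P θ), M.llr θs x = ((M.llr θs x).toReal : EReal) :=
    (hD.P_ac θ).ae_le (hD.ae_coe_toReal_llr θs)
  have hY := M.measurable_llr θs
  set e := walkCost (M.P θ) (M.llr θs) 0 1 with he
  have hem : Measurable e := measurable_walkCost hY measurable_one
  have he0 : e 0 < 1 := walkCost_ruin_zero_lt_one hY hfin hint (hθs θ)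
  have he1 : ∀ w, e w ≤ 1 := walkCost_ruin_le_one
  set K : ℝ≥0∞ := ENNReal.ofReal (1 + h / μ) with hK
  -- the expected number of skipped observations from the first step below zero on
  set B : ℝ≥0∞ := K / (1 - e 0) with hBdef
  have hsub0 : 1 - e 0 ≠ 0 := (tsub_pos_of_lt he0).ne'
  have hsubt : 1 - e 0 ≠ ∞ := (tsub_le_self.trans_lt ENNReal.one_lt_top).ne
  have hBtop : B ≠ ∞ := ENNReal.div_ne_top ENNReal.ofReal_ne_top hsub0
  have hB : K + e 0 * B = B := by
    calc K + e 0 * B = (1 - e 0) * B + e 0 * B := by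
          rw [hBdef, ENNReal.mul_div_cancel hsub0 hsubt]
      _ = B := by rw [← add_mul, tsub_add_cancel_of_le he0.le, one_mul]
  let j : EReal → ℝ≥0∞ := fun w => ENNReal.ofReal (1 - w.toReal / μ)
  have hj : Measurable j :=
    (measurable_const.sub (measurable_ereal_toReal.div_const μ)).ennreal_ofReal
  let V : EReal → ℝ≥0∞ := fun w => if w < 0 then j w + e 0 * B else e w * B
  have hV : Measurable V := Measurable.ite measurableSet_Iio (hj.add measurable_const)
    (hem.mul measurable_const)
  have hVneg : ∀ u : ℝ, u < 0 → V u = ENNReal.ofReal (1 - u / μ) + e 0 * B := fun u hu => by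
    have hu' : (u : EReal) < 0 := by exact_mod_cast hu
    simp [V, hu', j]
  have hVnonneg : ∀ w : EReal, 0 ≤ w → V w = e w * B := fun w hw => by simp [V, hw.not_gt]
  have hVle : ∀ w : EReal, ((-h : ℝ) : EReal) ≤ w → V w ≤ B := by
    intro w hw
    rcases lt_or_ge w 0 with h0 | h0
    · induction w with
      | bot => exact absurd hw (by simp)
      | top => exact absurd h0 (by simp)
      | coe u =>
        have hhu : -h ≤ u := by exact_mod_cast hw
        rw [hVneg u (by exact_mod_cast h0)]
        refine le_trans (add_le_add_left (ENNReal.ofReal_le_ofReal ?_) _) hB.le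
        rw [sub_eq_add_neg, ← neg_div]
        gcongr
        linarith
    · rw [hVnonneg w h0]
      exact (mul_le_mul_left (he1 w) B).trans_eq (one_mul B)
  refine ⟨V, B, hV, hBtop, fun n ω => ⟨hVle _ (M.neg_le_pathW θs hμ.le hh n ω), ?_⟩⟩
  rcases lt_or_ge (M.pathW θs μ h n ω) 0 with hw | hw
  · obtain ⟨u, hu, hhu, hu0⟩ := M.exists_coe_pathW θs hμ.le hh hw
    rw [hu]
    have hu0' : ¬ (0 : EReal) ≤ u := by exact_mod_cast not_le.2 hu0
    simp only [deStep, hu0', if_false, lintegral_const, measure_univ, mul_one]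
    rw [hVneg u hu0, ← EReal.coe_add]
    rcases lt_or_ge (u + μ) 0 with hlt | hge
    · have hnn : 0 ≤ 1 - (u + μ) / μ := by
        have : (u + μ) / μ ≤ 0 := div_nonpos_of_nonpos_of_nonneg hlt.le hμ.le
        linarith
      rw [min_eq_left (by exact_mod_cast hlt.le), hVneg _ hlt, ← add_assoc, ← ENNReal.ofReal_one,
        ← ENNReal.ofReal_add zero_le_one hnn]
      refine le_of_eq ?_
      congr 2
      field_simp
      ring
    · rw [min_eq_right (by exact_mod_cast hge), hVnonneg 0 le_rfl]
      refine add_le_add_left ?_ _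
      rw [← ENNReal.ofReal_one]
      refine ENNReal.ofReal_le_ofReal ?_
      have : u / μ ≤ 0 := div_nonpos_of_nonpos_of_nonneg hu0.le hμ.le
      linarith
  · generalize M.pathW θs μ h n ω = w at hw
    rw [if_pos hw, zero_add, hVnonneg w hw, he, walkCost_of_nonneg hY measurable_one hw, zero_add,
      ← he, ← lintegral_mul_const' _ _ hBtop]
    refine lintegral_mono fun x => ?_
    simp only [deStep, hw, if_true]
    rcases lt_or_ge (w + M.llr θs x) 0 with hlt | hge
    · have : e (w + M.llr θs x) = 1 := walkCost_of_neg hlt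
      rw [this, one_mul]
      exact hVle _ (le_max_right _ _)
    · rw [max_eq_left ((show ((-h : ℝ) : EReal) ≤ 0 by exact_mod_cast neg_nonpos.2 hh).trans hge),
        hVnonneg _ hge]

/-! ### The generalized likelihood ratio statistic as a family of CuSum statistics -/

section Cusum

variable (M) (θ : Θ)

/-- The nonnegative CuSum statistic of the first `p` terms of a sequence of used observations. -/
noncomputable def cusum : ℕ → (ℕ → 𝓧) → EReal
  | 0, _ => 0
  | p + 1, y => max (cusum p y + M.llr θ (y p)) 0

/-- The nonnegative CuSum statistic of a record; skipped observations leave it unchanged. -/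
noncomputable def recordCusum : (n : ℕ) → (Fin n → Obs 𝓧) → EReal
  | 0, _ => 0
  | n + 1, I => max (recordCusum n (Fin.init I) + M.llrObs θ (I (Fin.last n))) 0

lemma cusum_nonneg (p : ℕ) (y : ℕ → 𝓧) : 0 ≤ M.cusum θ p y := by
  cases p
  · exact le_rfl
  · exact le_max_right _ _

lemma recordCusum_nonneg (n : ℕ) (I : Fin n → Obs 𝓧) : 0 ≤ M.recordCusum θ n I := by
  cases n
  · exact le_rfl
  · exact le_max_right _ _

lemma cusum_congr {p : ℕ} {y y' : ℕ → 𝓧} (h : ∀ i < p, y i = y' i) :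
    M.cusum θ p y = M.cusum θ p y' := by
  induction p with
  | zero => rfl
  | succ p ih => simp only [cusum, ih fun i hi => h i (by omega), h p (by omega)]

lemma cusum_update_succ (p : ℕ) (y : ℕ → 𝓧) (x : 𝓧) :
    M.cusum θ (p + 1) (Function.update y p x) = max (M.cusum θ p y + M.llr θ x) 0 := by
  rw [cusum, Function.update_self,
    M.cusum_congr θ fun i (hi : i < p) => Function.update_of_ne hi.ne x y]

/-- Forgetting an initial segment of the observations does not increase the CuSum statistic. -/
lemma cusum_shift_le (p q : ℕ) (y : ℕ → 𝓧) :
    M.cusum θ q (fun i => y (p + i)) ≤ M.cusum θ (p + q) y := by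
  induction q with
  | zero => exact M.cusum_nonneg θ _ _
  | succ q ih =>
    rw [← add_assoc]
    simp only [cusum]
    gcongr

lemma recordCusum_record_succ (φ : Control 𝓧) (n : ℕ) (ω : ℕ → 𝓧) :
    M.recordCusum θ (n + 1) (record φ (n + 1) ω) =
      if used φ n ω then max (M.recordCusum θ n (record φ n ω) + M.llr θ (ω n)) 0
      else M.recordCusum θ n (record φ n ω) := by
  rw [recordCusum, init_record_succ, record_succ_last]
  split_ifs
  · rfl
  · simp [llrObs, recordCusum_nonneg]

lemma sum_Ici_castSucc {n : ℕ} (g : Fin (n + 1) → EReal) (k : Fin n) :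
    ∑ i ∈ Finset.Ici k.castSucc, g i = ∑ i ∈ Finset.Ici k, g i.castSucc + g (Fin.last n) := by
  have h1 : ∀ {m : ℕ} (k : Fin m) (g : Fin m → EReal),
      ∑ i ∈ Finset.Ici k, g i = ∑ i, if k ≤ i then g i else 0 := fun k g => by
    rw [← Finset.sum_filter]
    congr 1
    ext i
    simp
  rw [h1, h1, Fin.sum_univ_castSucc]
  simp [Fin.le_last]

lemma max_iSup_sum_Ici (n : ℕ) (I : Fin n → Obs 𝓧) :
    max (⨆ k : Fin n, ∑ i ∈ Finset.Ici k, M.llrObs θ (I i)) 0 = M.recordCusum θ n I := by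
  induction n with
  | zero => simp [recordCusum]
  | succ n ih =>
    have hlast : ∑ i ∈ Finset.Ici (Fin.last n), M.llrObs θ (I i) =
        M.llrObs θ (I (Fin.last n)) := by
      rw [show Finset.Ici (Fin.last n) = {Fin.last n} by ext i; simp [Fin.last_le_iff]]
      simp
    have hcast : ∀ k : Fin n, ∑ i ∈ Finset.Ici k.castSucc, M.llrObs θ (I i) =
        ∑ i ∈ Finset.Ici k, M.llrObs θ (Fin.init (α := fun _ => Obs 𝓧) I i) +
          M.llrObs θ (I (Fin.last n)) := fun k =>
      sum_Ici_castSucc (fun i => M.llrObs θ (I i)) k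
    have ih' := ih (Fin.init I)
    rw [recordCusum]
    refine le_antisymm (max_le (iSup_le fun k => ?_) (le_max_right _ _))
      (max_le ?_ (le_max_right _ _))
    · refine le_trans ?_ (le_max_left _ _)
      refine Fin.lastCases ?_ (fun j => ?_) k
      · rw [hlast]
        exact le_add_of_nonneg_left (M.recordCusum_nonneg θ n _)
      · rw [hcast, ← ih']
        gcongr
        exact (le_iSup (fun k : Fin n => ∑ i ∈ Finset.Ici k,
          M.llrObs θ (Fin.init (α := fun _ => Obs 𝓧) I i)) j).trans (le_max_left _ _)
    · rw [← ih']
      refine le_trans ?_ (le_max_left _ _)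
      rcases le_total (⨆ k : Fin n, ∑ i ∈ Finset.Ici k,
          M.llrObs θ (Fin.init (α := fun _ => Obs 𝓧) I i)) 0 with h0 | h0
      · rw [max_eq_right h0, zero_add, ← hlast]
        exact le_iSup (fun k => ∑ i ∈ Finset.Ici k, M.llrObs θ (I i)) (Fin.last n)
      · rw [max_eq_left h0]
        rcases isEmpty_or_nonempty (Fin n) with hn | hn
        · simp
        · obtain ⟨k, hk⟩ := exists_eq_ciSup_of_finite (f := fun k : Fin n =>
            ∑ i ∈ Finset.Ici k, M.llrObs θ (Fin.init (α := fun _ => Obs 𝓧) I i))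
          rw [← hk, ← hcast]
          exact le_iSup (fun k => ∑ i ∈ Finset.Ici k, M.llrObs θ (I i)) k.castSucc

variable {θ} (T : Set Θ) {A : ℝ}

/-- For a positive threshold, the generalized likelihood ratio statistic reaches the threshold if
and only if the supremum of the nonnegative CuSum statistics does. -/
lemma le_glr_iff (hA : 0 < A) (n : ℕ) (I : Fin n → Obs 𝓧) :
    (A : EReal) ≤ M.glr T n I ↔ (A : EReal) ≤ ⨆ θ ∈ T, M.recordCusum θ n I := by
  simp only [← max_iSup_sum_Ici]
  constructor
  · refine fun hle => hle.trans (iSup_le fun k => iSup₂_le fun θ hθ => ?_)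
    refine le_iSup₂_of_le θ hθ (le_max_of_le_left ?_)
    exact le_iSup (fun k : Fin n => ∑ i ∈ Finset.Ici k, M.llrObs θ (I i)) k
  · intro hle
    have h1 : (A : EReal) ≤ max (M.glr T n I) 0 := by
      refine hle.trans (iSup₂_le fun θ hθ => max_le_max (iSup_le fun k => ?_) le_rfl)
      exact le_iSup_of_le k (le_iSup₂_of_le (f := fun θ (_ : θ ∈ T) =>
        ∑ i ∈ Finset.Ici k, M.llrObs θ (I i)) θ hθ le_rfl)
    rcases le_max_iff.1 h1 with h2 | h2
    · exact h2
    · exact absurd (show A ≤ 0 by exact_mod_cast h2) hA.not_ge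

lemma lt_crossingTime_iff (φ : Control 𝓧) (A : ℝ) (ω : ℕ → 𝓧) (n : ℕ) :
    (n : ℕ∞) < M.crossingTime φ T A ω ↔
      ∀ m ≤ n, 1 ≤ m → ¬ (A : EReal) ≤ M.glr T m (record φ m ω) := by
  constructor
  · intro hlt m hm h1 hA
    have : M.crossingTime φ T A ω ≤ (m : ℕ∞) := iInf₂_le m ⟨h1, hA⟩
    have h2 := hlt.trans_le this
    exact absurd (show n < m by exact_mod_cast h2) (by omega)
  · intro hno
    have : ((n + 1 : ℕ) : ℕ∞) ≤ M.crossingTime φ T A ω := by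
      refine le_iInf₂ fun m hm => ?_
      have : n < m := by
        by_contra hc
        exact hno m (by omega) hm.1 hm.2
      exact_mod_cast this
    refine lt_of_lt_of_le ?_ this
    exact_mod_cast Nat.lt_succ_self n

lemma lt_crossingTime_iff_recordCusum (φ : Control 𝓧) (hA : 0 < A) (ω : ℕ → 𝓧) (n : ℕ) :
    (n : ℕ∞) < M.crossingTime φ T A ω ↔
      ∀ m ≤ n, ⨆ θ ∈ T, M.recordCusum θ m (record φ m ω) < A := by
  rw [lt_crossingTime_iff]
  simp only [M.le_glr_iff T hA, not_le]
  refine ⟨fun hno m hm => ?_, fun hno m hm _ => hno m hm⟩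
  rcases Nat.eq_zero_or_pos m with rfl | hpos
  · refine lt_of_le_of_lt (iSup₂_le fun θ _ => le_rfl) (?_ : (0 : EReal) < A)
    exact_mod_cast hA
  · exact hno m hm hpos

variable (A)

/-- The sequences of used observations whose CuSum statistics stay below the threshold `A` up to
and including time `p`. -/
def noAlarm (p : ℕ) : Set (ℕ → 𝓧) := {y | ∀ m ≤ p, ⨆ θ ∈ T, M.cusum θ m y < A}

variable {A}

lemma noAlarm_update_succ {p : ℕ} {y : ℕ → 𝓧} {x : 𝓧} :
    Function.update y p x ∈ M.noAlarm T A (p + 1) ↔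
      y ∈ M.noAlarm T A p ∧ ⨆ θ ∈ T, M.cusum θ (p + 1) (Function.update y p x) < A := by
  have hc : ∀ m ≤ p, ∀ θ, M.cusum θ m (Function.update y p x) = M.cusum θ m y := fun m hm θ =>
    M.cusum_congr θ fun i hi => Function.update_of_ne (by omega) x y
  constructor
  · intro hy
    refine ⟨fun m hm => ?_, hy (p + 1) le_rfl⟩
    have := hy m (by omega)
    simpa only [hc m hm] using this
  · rintro ⟨hy, hlast⟩ m hm
    rcases Nat.lt_or_ge p m with hlt | hle
    · obtain rfl : m = p + 1 := by omega
      exact hlast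
    · simpa only [hc m hle] using hy m hle

/-- The GCuSum test has not stopped by time `n` if and only if the observations up to time `n`
raise no alarm. -/
lemma lt_alarm_GCuSum_iff (hA : 0 < A) (ω : ℕ → 𝓧) (n : ℕ) :
    (n : ℕ∞) < (M.GCuSum T A).alarm ω ↔ ω ∈ M.noAlarm T A n := by
  have hrec : ∀ θ m, M.recordCusum θ m (record (fun _ _ => true) m ω) = M.cusum θ m ω := by
    intro θ m
    induction m with
    | zero => rfl
    | succ m ih =>
      rw [recordCusum_record_succ, ih]
      simp [used, cusum]
  rw [GCuSum, M.lt_crossingTime_iff_recordCusum T _ hA]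
  simp only [hrec]
  rfl

end Cusum

end Model

/-! ### The buffer of used observations -/

section Buffer

variable {𝓧 : Type*}

/-- Append an observation to a buffer; the buffer `(p, y)` holds `y 0, …, y (p - 1)`. -/
def push (b : ℕ × (ℕ → 𝓧)) (x : 𝓧) : ℕ × (ℕ → 𝓧) := (b.1 + 1, Function.update b.2 b.1 x)

/-- The observations that the control `φ` uses among those with the indices `s, …, s + k - 1`.
The values of `y₀` fill the unused part of the buffer. -/
def buffer (φ : Control 𝓧) (s : ℕ) (y₀ : ℕ → 𝓧) : ℕ → (ℕ → 𝓧) → ℕ × (ℕ → 𝓧)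
  | 0, _ => (0, y₀)
  | k + 1, ω =>
    if used φ (s + k) ω then push (buffer φ s y₀ k ω) (ω (s + k)) else buffer φ s y₀ k ω

lemma buffer_update (φ : Control 𝓧) (s : ℕ) (y₀ : ℕ → 𝓧) {k n : ℕ} (hn : s + k ≤ n)
    (ω : ℕ → 𝓧) (x : 𝓧) :
    buffer φ s y₀ k (Function.update ω n x) = buffer φ s y₀ k ω := by
  induction k with
  | zero => rfl
  | succ k ih =>
    simp only [buffer, ih (by omega), used_update φ (show s + k ≤ n by omega),
      Function.update_of_ne (show s + k ≠ n by omega)]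

lemma buffer_fst_le (φ : Control 𝓧) (s : ℕ) (y₀ : ℕ → 𝓧) (k : ℕ) (ω : ℕ → 𝓧) :
    (buffer φ s y₀ k ω).1 ≤ k := by
  induction k with
  | zero => exact le_rfl
  | succ k ih =>
    rw [buffer]
    split_ifs
    · simpa [push] using ih
    · exact ih.trans (Nat.le_succ k)

variable [MeasurableSpace 𝓧]

lemma measurable_push : Measurable fun q : (ℕ × (ℕ → 𝓧)) × 𝓧 => push q.1 q.2 := by
  refine Measurable.prodMk ((measurable_from_nat (f := fun p => p + 1)).comp
    (measurable_fst.comp measurable_fst)) (measurable_pi_iff.2 fun i => ?_)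
  have hset : MeasurableSet {q : (ℕ × (ℕ → 𝓧)) × 𝓧 | i = q.1.1} :=
    (measurable_fst.comp measurable_fst) (measurableSet_eq (a := i)) |> fun h => by
      simpa [Set.preimage, eq_comm] using h
  simp only [Function.update_apply]
  exact Measurable.ite hset measurable_snd
    ((measurable_pi_apply i).comp (measurable_snd.comp measurable_fst))

/-- The buffer is a measurable function of the record. -/
lemma measurable_buffer_infoSigma (φ : Control 𝓧) (y₀ : ℕ → 𝓧) (n : ℕ) :
    Measurable[infoSigma φ n] (buffer φ 0 y₀ n) := by
  induction n with
  | zero => exact measurable_const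
  | succ n ih =>
    have hb : Measurable[infoSigma φ (n + 1)] (buffer φ 0 y₀ n) :=
      ih.mono (infoSigma_mono φ n) le_rfl
    have hlast : Measurable[infoSigma φ (n + 1)] fun ω => record φ (n + 1) ω (Fin.last n) :=
      (measurable_pi_apply (Fin.last n)).comp (comap_measurable _)
    have h := (measurable_obs_elim (f := fun q : (ℕ × (ℕ → 𝓧)) × 𝓧 => push q.1 q.2)
      measurable_push measurable_id).comp (hb.prodMk hlast)
    convert h using 1
    ext1 ω
    simp only [Function.comp_apply, record_succ_last, buffer, zero_add]
    split_ifs <;> rfl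

end Buffer

namespace Model

variable {𝓧 Θ : Type*} [MeasurableSpace 𝓧] (M : Model 𝓧 Θ) (T : Set Θ) {A : ℝ}

/-- Started afresh at any time, the CuSum statistic of the used observations is at most that of
the whole record. -/
lemma cusum_buffer_le (θ : Θ) (φ : Control 𝓧) (s : ℕ) (y₀ : ℕ → 𝓧) (k : ℕ) (ω : ℕ → 𝓧) :
    M.cusum θ (buffer φ s y₀ k ω).1 (buffer φ s y₀ k ω).2 ≤
      M.recordCusum θ (s + k) (record φ (s + k) ω) := by
  induction k with
  | zero => exact M.recordCusum_nonneg θ _ _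
  | succ k ih =>
    rw [← add_assoc, recordCusum_record_succ, buffer]
    split_ifs
    · rw [push, cusum_update_succ]
      gcongr
    · exact ih

lemma cusum_buffer_zero (θ : Θ) (φ : Control 𝓧) (y₀ : ℕ → 𝓧) (n : ℕ) (ω : ℕ → 𝓧) :
    M.cusum θ (buffer φ 0 y₀ n ω).1 (buffer φ 0 y₀ n ω).2 =
      M.recordCusum θ n (record φ n ω) := by
  induction n with
  | zero => rfl
  | succ n ih =>
    rw [recordCusum_record_succ, buffer, zero_add]
    split_ifs
    · rw [push, cusum_update_succ, ih]
    · exact ih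

/-- As long as the test with control `φ` has raised no alarm, the GCuSum test applied to the
observations used since time `s` has raised none. -/
lemma buffer_mem_noAlarm (φ : Control 𝓧) (hA : 0 < A) (s : ℕ) (y₀ : ℕ → 𝓧) (k : ℕ) (ω : ℕ → 𝓧)
    (hlt : ((s + k : ℕ) : ℕ∞) < M.crossingTime φ T A ω) :
    (buffer φ s y₀ k ω).2 ∈ M.noAlarm T A (buffer φ s y₀ k ω).1 := by
  rw [M.lt_crossingTime_iff_recordCusum T φ hA] at hlt
  have hk : ∀ j ≤ k, ⨆ θ ∈ T, M.cusum θ (buffer φ s y₀ j ω).1 (buffer φ s y₀ j ω).2 < A :=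
    fun j hj => (iSup₂_mono fun θ _ => M.cusum_buffer_le θ φ s y₀ j ω).trans_lt
      (hlt (s + j) (by omega))
  clear hlt
  induction k with
  | zero =>
    intro m hm
    obtain rfl : m = 0 := by simpa [buffer] using hm
    exact hk 0 le_rfl
  | succ k ih =>
    have ih' := ih fun j hj => hk j (by omega)
    have hlast := hk (k + 1) le_rfl
    rw [buffer] at hlast ⊢
    split_ifs at hlast ⊢
    · exact (M.noAlarm_update_succ T).2 ⟨ih', hlast⟩
    · exact ih'

lemma lt_crossingTime_iff_buffer (φ : Control 𝓧) (hA : 0 < A) (y₀ : ℕ → 𝓧) (n : ℕ)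
    (ω : ℕ → 𝓧) : (n : ℕ∞) < M.crossingTime φ T A ω ↔
      (buffer φ 0 y₀ n ω).2 ∈ M.noAlarm T A (buffer φ 0 y₀ n ω).1 := by
  refine ⟨fun hlt => M.buffer_mem_noAlarm T φ hA 0 y₀ n ω (by simpa using hlt), fun hmem => ?_⟩
  rw [M.lt_crossingTime_iff_recordCusum T φ hA]
  simp only [← M.cusum_buffer_zero _ φ y₀]
  induction n with
  | zero =>
    intro m hm
    obtain rfl : m = 0 := by omega
    exact hmem 0 le_rfl
  | succ n ih =>
    intro m hm
    rcases Nat.lt_or_ge n m with hlt | hle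
    · obtain rfl : m = n + 1 := by omega
      exact hmem _ le_rfl
    · refine ih ?_ m hle
      rw [buffer] at hmem
      split_ifs at hmem
      · exact ((M.noAlarm_update_succ T).1 hmem).1
      · exact hmem

end Model

/-! ### Survival probabilities of stopping rules for independent observations -/

section Survival

variable {𝓧 : Type*} [MeasurableSpace 𝓧]

/-- The continuation sets of a stopping rule: `N p` is the event that the rule has not stopped
within the first `p` observations. The rule may only stop earlier if it is given additional
observations at the beginning, which is the condition `shift`. -/
structure IsContinuation (N : ℕ → Set (ℕ → 𝓧)) : Prop where
  measurableSet : ∀ p, MeasurableSet (N p)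
  congr : ∀ p y y', (∀ i < p, y i = y' i) → y ∈ N p → y' ∈ N p
  anti : ∀ p, N (p + 1) ⊆ N p
  shift : ∀ p q y, y ∈ N (p + q) → (fun i => y (p + i)) ∈ N q

/-- The probability that the rule with continuation sets `N` does not stop within `p + m`
observations, of which the first `p` are `y 0, …, y (p - 1)` and the others have law `ρ`. -/
noncomputable def survival (ρ : Measure 𝓧) (N : ℕ → Set (ℕ → 𝓧)) :
    ℕ → ℕ → (ℕ → 𝓧) → ℝ≥0∞
  | 0, p, y => (N p).indicator 1 y
  | m + 1, p, y => ∫⁻ x, survival ρ N m (p + 1) (Function.update y p x) ∂ρ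

/-- The expected number of times at which the rule with continuation sets `N` has not yet stopped,
counted from the time `p` on, given the first `p` observations. -/
noncomputable def remaining (ρ : Measure 𝓧) (N : ℕ → Set (ℕ → 𝓧)) (p : ℕ) (y : ℕ → 𝓧) : ℝ≥0∞ :=
  ∑' m, survival ρ N m p y

variable {ρ : Measure 𝓧} [IsProbabilityMeasure ρ] {N : ℕ → Set (ℕ → 𝓧)} (hN : IsContinuation N)
include hN

lemma IsContinuation.indicator_congr {p : ℕ} {y y' : ℕ → 𝓧} (h : ∀ i < p, y i = y' i) :
    (N p).indicator (1 : (ℕ → 𝓧) → ℝ≥0∞) y = (N p).indicator 1 y' := by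
  have hiff : y ∈ N p ↔ y' ∈ N p :=
    ⟨hN.congr p y y' h, hN.congr p y' y fun i hi => (h i hi).symm⟩
  by_cases hy : y ∈ N p
  · simp [hy, hiff.1 hy]
  · simp [hy, mt hiff.2 hy]

omit [IsProbabilityMeasure ρ] in
lemma IsContinuation.survival_congr (m : ℕ) {p : ℕ} {y y' : ℕ → 𝓧} (h : ∀ i < p, y i = y' i) :
    survival ρ N m p y = survival ρ N m p y' := by
  induction m generalizing p y y' with
  | zero => exact hN.indicator_congr h
  | succ m ih =>
    refine lintegral_congr fun x => ih fun i hi => ?_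
    rcases Nat.lt_succ_iff_lt_or_eq.1 hi with hlt | rfl
    · simp [Function.update_of_ne hlt.ne, h i hlt]
    · simp

lemma IsContinuation.measurable_survival (m p : ℕ) : Measurable (survival ρ N m p) := by
  induction m generalizing p with
  | zero => exact measurable_one.indicator (hN.measurableSet p)
  | succ m ih =>
    exact Measurable.lintegral_prod_right' (f := fun q : (ℕ → 𝓧) × 𝓧 =>
      survival ρ N m (p + 1) (Function.update q.1 p q.2)) ((ih _).comp (measurable_update_coord p))

lemma IsContinuation.measurable_remaining (p : ℕ) : Measurable (remaining ρ N p) :=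
  Measurable.tsum fun m => hN.measurable_survival m p

lemma IsContinuation.survival_le_indicator (m p : ℕ) (y : ℕ → 𝓧) :
    survival ρ N m p y ≤ (N p).indicator 1 y := by
  induction m generalizing p y with
  | zero => exact le_rfl
  | succ m ih =>
    refine (lintegral_mono fun x => (ih (p + 1) _).trans
      (Set.indicator_le_indicator_of_subset (hN.anti p) (fun _ => zero_le) _)).trans_eq ?_
    rw [lintegral_congr fun x => hN.indicator_congr (y' := y)
      fun i hi => Function.update_of_ne hi.ne x y]
    simp

/-- Averaging the conditional survival probabilities gives the survival probability. Only the law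
of the observations `p, …, p + m - 1` matters. -/
lemma IsContinuation.lintegral_survival (μ : ℕ → Measure 𝓧) [∀ i, IsProbabilityMeasure (μ i)]
    (m p : ℕ) (hμ : ∀ i, p ≤ i → i < p + m → μ i = ρ) :
    ∫⁻ ω, survival ρ N m p ω ∂(Measure.infinitePi μ) = Measure.infinitePi μ (N (p + m)) := by
  induction m generalizing p with
  | zero => exact lintegral_indicator_one (hN.measurableSet p)
  | succ m ih =>
    rw [show p + (m + 1) = (p + 1) + m by omega,
      ← ih (p + 1) fun i h1 h2 => hμ i (by omega) (by omega),
      lintegral_update μ p (hN.measurable_survival m (p + 1)), hμ p le_rfl (by omega)]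
    rfl

lemma IsContinuation.survival_eq_measure (μ : ℕ → Measure 𝓧) [∀ i, IsProbabilityMeasure (μ i)]
    (m : ℕ) (hμ : ∀ i < m, μ i = ρ) (y : ℕ → 𝓧) :
    survival ρ N m 0 y = Measure.infinitePi μ (N m) := by
  have h := hN.lintegral_survival (ρ := ρ) μ m 0 fun i _ hi => hμ i (by omega)
  rw [lintegral_congr fun ω => hN.survival_congr m (p := 0) (y := ω) (y' := y)
    (by simp)] at h
  simpa using h

lemma IsContinuation.survival_zero_right (m : ℕ) (y : ℕ → 𝓧) :
    survival ρ N m 0 y = (Measure.infinitePi fun _ : ℕ => ρ) (N m) :=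
  hN.survival_eq_measure (fun _ => ρ) m (fun _ _ => rfl) y

/-- Given any past, the survival probability is at most that of a fresh start. -/
lemma IsContinuation.survival_le_fresh (m p : ℕ) (y : ℕ → 𝓧) :
    survival ρ N m p y ≤ (Measure.infinitePi fun _ : ℕ => ρ) (N m) := by
  have key : ∀ (m q : ℕ) (y : ℕ → 𝓧),
      survival ρ N m (p + q) y ≤ survival ρ N m q fun i => y (p + i) := by
    intro m
    induction m with
    | zero =>
      intro q y
      by_cases hy : y ∈ N (p + q)
      · simp [survival, hy, hN.shift p q y hy]
      · simp [survival, hy]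
    | succ m ih =>
      intro q y
      refine lintegral_mono fun x => (ih (q + 1) _).trans_eq ?_
      congr 1
      ext i
      by_cases hi : i = q
      · subst hi
        simp
      · rw [Function.update_of_ne hi, Function.update_of_ne (by omega)]
  simpa [hN.survival_zero_right] using key m 0 y

/-- Survival over two consecutive blocks is submultiplicative. -/
lemma IsContinuation.measure_add_le (p m : ℕ) :
    (Measure.infinitePi fun _ : ℕ => ρ) (N (p + m)) ≤
      (Measure.infinitePi fun _ : ℕ => ρ) (N p) * (Measure.infinitePi fun _ : ℕ => ρ) (N m) := by
  rw [← hN.lintegral_survival (fun _ => ρ) m p fun _ _ _ => rfl, ← lintegral_indicator_one (hN.measurableSet p),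
    ← lintegral_mul_const _ (measurable_one.indicator (hN.measurableSet p))]
  refine lintegral_mono fun ω => ?_
  by_cases hω : ω ∈ N p
  · simpa [hω] using hN.survival_le_fresh m p ω
  · simpa [hω] using hN.survival_le_indicator (ρ := ρ) m p ω

/-- A rule that stops within `n` observations with probability at least `1 - q` stops within
`n / (1 - q)` observations in the mean. -/
lemma IsContinuation.tsum_measure_le {n : ℕ} (hn : 0 < n) :
    ∑' k, (Measure.infinitePi fun _ : ℕ => ρ) (N k) ≤
      n * (1 - (Measure.infinitePi fun _ : ℕ => ρ) (N n))⁻¹ := by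
  set Q := Measure.infinitePi fun _ : ℕ => ρ with hQ
  have hanti : Antitone N := antitone_nat_of_succ_le hN.anti
  have hpow : ∀ j, Q (N (n * j)) ≤ Q (N n) ^ j := by
    intro j
    induction j with
    | zero => simpa using prob_le_one
    | succ j ih =>
      rw [Nat.mul_succ, pow_succ]
      exact (hN.measure_add_le _ _).trans (mul_le_mul_left ih _)
  have : NeZero n := ⟨hn.ne'⟩
  rw [← (Nat.divModEquiv n).symm.tsum_eq, ENNReal.tsum_prod', ← ENNReal.tsum_geometric,
    ← ENNReal.tsum_mul_left]
  refine ENNReal.tsum_le_tsum fun j => ?_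
  rw [tsum_fintype]
  refine (Finset.sum_le_card_nsmul _ _ (Q (N n) ^ j) fun i _ => ?_).trans_eq (by simp)
  refine (measure_mono (hanti ?_)).trans (hpow j)
  simp [Nat.divModEquiv, mul_comm]

/-- The expected remaining time decreases in the mean by one per observation until the rule
stops. -/
lemma IsContinuation.remaining_eq (p : ℕ) (y : ℕ → 𝓧) :
    remaining ρ N p y = (N p).indicator 1 y +
      ∫⁻ x, remaining ρ N (p + 1) (Function.update y p x) ∂ρ := by
  have hm : ∀ m, Measurable fun x => survival ρ N m (p + 1) (Function.update y p x) := fun m =>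
    (hN.measurable_survival m (p + 1)).comp
      ((measurable_update_coord p).comp measurable_prodMk_left)
  simp only [remaining]
  rw [lintegral_tsum fun m => (hm m).aemeasurable, tsum_eq_zero_add' ENNReal.summable]
  rfl

lemma IsContinuation.remaining_zero (y : ℕ → 𝓧) :
    remaining ρ N 0 y = ∑' m, (Measure.infinitePi fun _ : ℕ => ρ) (N m) :=
  tsum_congr fun m => hN.survival_zero_right m y

omit hN in
/-- Among the rules with continuation sets as above, those that stop late under `ρ` stop late
under every law `κ ≪ ρ`: a bounded mean under `κ` entails a bounded mean under `ρ`. The bound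
`c` depends on `ρ`, `κ` and `K` only. -/
lemma exists_tsum_measure_le {κ : Measure 𝓧} [IsProbabilityMeasure κ]
    (hac : κ ≪ ρ) (K : ℕ) : ∃ c : ℝ≥0∞, c ≠ ∞ ∧ ∀ N : ℕ → Set (ℕ → 𝓧), IsContinuation N →
      ∑' k, (Measure.infinitePi fun _ : ℕ => κ) (N k) < K →
      ∑' k, (Measure.infinitePi fun _ : ℕ => ρ) (N k) ≤ c := by
  set n := 2 * K + 1 with hn
  have hinst : ∀ i, IsProbabilityMeasure (if i < n then κ else ρ : Measure 𝓧) := fun i => by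
    split_ifs <;> infer_instance
  set R := Measure.infinitePi (fun i => if i < n then κ else ρ) with hR
  set Q := Measure.infinitePi fun _ : ℕ => ρ with hQ
  have hRQ : R ≪ Q := infinitePi_ite_absolutelyContinuous hac n
  have hfin : ∫⁻ ω, R.rnDeriv Q ω ∂Q ≠ ∞ := (Measure.lintegral_rnDeriv_lt_top R Q).ne
  obtain ⟨δ, hδ, hsmall⟩ := exists_pos_setLIntegral_lt_of_measure_lt hfin
    (ENNReal.inv_ne_zero.2 (by simp : (2 : ℝ≥0∞) ≠ ∞))
  refine ⟨n * δ⁻¹, ENNReal.mul_ne_top (ENNReal.natCast_ne_top n) (ENNReal.inv_ne_top.2 hδ.ne'),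
    fun N hN hsum => (hN.tsum_measure_le (n := n) (by omega)).trans ?_⟩
  have hanti : Antitone N := antitone_nat_of_succ_le hN.anti
  have hRN : R (N n) = (Measure.infinitePi fun _ : ℕ => κ) (N n) := by
    obtain ⟨y⟩ : Nonempty (ℕ → 𝓧) := by
      by_contra hc
      rw [not_nonempty_iff] at hc
      have := measure_univ (μ := Q)
      rw [Set.univ_eq_empty_iff.2 hc] at this
      simp at this
    rw [← hN.survival_zero_right (ρ := κ) n y]
    exact (hN.survival_eq_measure _ n (fun i hi => by simp [hi]) y).symm
  -- Markov's inequality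
  have hhalf : (Measure.infinitePi fun _ : ℕ => κ) (N n) ≤ 2⁻¹ := by
    have h1 : (n : ℝ≥0∞) * (Measure.infinitePi fun _ : ℕ => κ) (N n) ≤ K := by
      refine le_trans ?_ hsum.le
      refine le_trans ?_ (ENNReal.sum_le_tsum (Finset.range n))
      simpa using Finset.card_nsmul_le_sum (Finset.range n)
        (fun k => (Measure.infinitePi fun _ : ℕ => κ) (N k)) _
        fun k hk => measure_mono (hanti (Finset.mem_range.1 hk).le)
    rw [ENNReal.le_inv_iff_mul_le]
    have hK : (K : ℝ≥0∞) * 2 ≤ n := by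
      have : K * 2 ≤ n := by omega
      exact_mod_cast this
    have hn0 : (n : ℝ≥0∞) ≠ 0 := by
      have : n ≠ 0 := by omega
      exact_mod_cast this
    have h2 : (n : ℝ≥0∞) * ((Measure.infinitePi fun _ : ℕ => κ) (N n) * 2) ≤ n * 1 := by
      rw [← mul_assoc, mul_one]
      exact (mul_le_mul_left h1 2).trans hK
    exact (ENNReal.mul_le_mul_iff_right hn0 (ENNReal.natCast_ne_top n)).1 h2
  have hδQ : δ ≤ Q (N n)ᶜ := by
    by_contra hc
    have h1 := hsmall _ (not_le.1 hc)
    rw [Measure.setLIntegral_rnDeriv hRQ, prob_compl_eq_one_sub (hN.measurableSet n), hRN] at h1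
    refine absurd h1 (not_lt.2 ?_)
    rw [← ENNReal.one_sub_inv_two]
    exact tsub_le_tsub_left hhalf 1
  rw [← prob_compl_eq_one_sub (hN.measurableSet n)]
  gcongr

end Survival

namespace Model

variable {𝓧 Θ : Type*} [MeasurableSpace 𝓧] {M : Model 𝓧 Θ}

/-! ### The GCuSum test -/

lemma Pchange_one (θ : Θ) : M.Pchange θ 1 = Measure.infinitePi fun _ => M.P θ := by
  simp [Pchange]

lemma measurableSet_le_alarm {Ψ : Policy 𝓧} (hΨ : Ψ.IsAdmissible) {γ : ℕ} (hγ : 1 ≤ γ) :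
    MeasurableSet[infoSigma Ψ.control (γ - 1)] {ω | (γ : ℕ∞) ≤ Ψ.alarm ω} := by
  have h := (hΨ.2 (γ - 1)).compl
  convert h using 1
  ext ω
  simp only [Set.mem_ofPred_eq, Set.mem_compl_iff, not_le]
  rw [← Order.add_one_le_iff_of_not_isMax (by simp)]
  rw [show (((γ - 1 : ℕ) : ℕ∞) + 1) = (γ : ℕ∞) by exact_mod_cast Nat.sub_add_cancel hγ]

section GCuSum

variable {T : Set Θ} {A : ℝ}

lemma isContinuation_noAlarm (hA : 0 < A) (hadm : (M.GCuSum T A).IsAdmissible) :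
    IsContinuation (M.noAlarm T A) where
  measurableSet p := by
    have h := (infoSigma_le hadm.1 p _ (hadm.2 p)).compl
    convert h using 1
    ext ω
    rw [← M.lt_alarm_GCuSum_iff T hA]
    simp
  congr p y y' h hy m hm := by
    have : ∀ θ, M.cusum θ m y' = M.cusum θ m y := fun θ =>
      M.cusum_congr θ fun i hi => (h i (by omega)).symm
    simpa only [this] using hy m hm
  anti p y hy m hm := hy m (by omega)
  shift p q y hy m hm :=
    (iSup₂_mono fun θ _ => M.cusum_shift_le θ p m y).trans_lt (hy (p + m) (by omega))

lemma lintegral_alarm_GCuSum (hA : 0 < A) (hadm : (M.GCuSum T A).IsAdmissible)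
    (P : Measure (ℕ → 𝓧)) :
    ∫⁻ ω, ((M.GCuSum T A).alarm ω : ℝ≥0∞) ∂P = ∑' n, P (M.noAlarm T A n) := by
  have hN := isContinuation_noAlarm hA hadm
  have hset : ∀ n : ℕ, {ω | (n : ℕ∞) < (M.GCuSum T A).alarm ω} = M.noAlarm T A n := fun n =>
    Set.ext fun ω => M.lt_alarm_GCuSum_iff T hA ω n
  rw [lintegral_toENNReal_eq_tsum P fun n => by rw [hset n]; exact hN.measurableSet n]
  exact tsum_congr fun n => by rw [hset n]

lemma one_le_alarm_GCuSum (ω : ℕ → 𝓧) : 1 ≤ (M.GCuSum T A).alarm ω :=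
  le_iInf₂ fun n hn => by exact_mod_cast hn.1

/-- With a nonpositive threshold the GCuSum test stops at the latest when the likelihood ratio of
a single observation is at least one, so that its false alarm rate is bounded below. -/
lemma FAR_GCuSum_ge_of_nonpos {θ : Θ} (hθ : θ ∈ T) (hA : A ≤ 0) :
    M.P₀ {x | 0 ≤ M.llr θ x} ≤ M.FAR (M.GCuSum T A) := by
  set S : Set 𝓧 := {x | M.llr θ x < 0} with hS
  have hSm : MeasurableSet S := (M.measurable_llr θ) measurableSet_Iio
  have hcompl : {x | 0 ≤ M.llr θ x} = Sᶜ := by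
    ext x
    simp [hS]
  have hsub : ∀ (n : ℕ) (ω : ℕ → 𝓧), (n : ℕ∞) < (M.GCuSum T A).alarm ω →
      ω ∈ Set.pi (Finset.range n : Set ℕ) fun _ => S := by
    intro n ω hlt i hi
    have hi' : i < n := by simpa using hi
    have hno := (M.lt_crossingTime_iff T _ A ω n).1 hlt (i + 1) hi' (by omega)
    by_contra hc
    have h0 : 0 ≤ M.llr θ (ω i) := not_lt.1 hc
    refine hno ?_
    have hone : M.llr θ (ω i) ≤ M.glr T (i + 1) (record (fun _ _ => true) (i + 1) ω) := by
      refine le_iSup_of_le (Fin.last i) (le_iSup₂_of_le θ hθ ?_)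
      rw [show Finset.Ici (Fin.last i) = {Fin.last i} by ext j; simp [Fin.last_le_iff],
        Finset.sum_singleton, record_succ_last]
      simp [used, llrObs]
    exact le_trans (by exact_mod_cast hA) (h0.trans hone)
  rw [FAR, hcompl, prob_compl_eq_one_sub hSm, ← inv_inv (1 - M.P₀ S), ENNReal.inv_le_inv,
    ← ENNReal.tsum_geometric]
  simp only [toENNReal_eq_tsum]
  have hm : ∀ n : ℕ, MeasurableSet (Set.pi (Finset.range n : Set ℕ) fun _ => S) := fun n =>
    MeasurableSet.pi (Finset.countable_toSet _) fun _ _ => hSm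
  calc ∫⁻ ω, ∑' n : ℕ, (if (n : ℕ∞) < (M.GCuSum T A).alarm ω then (1 : ℝ≥0∞) else 0) ∂M.Pinf
      ≤ ∫⁻ ω, ∑' n : ℕ, (Set.pi (Finset.range n : Set ℕ) fun _ => S).indicator 1 ω ∂M.Pinf := by
        refine lintegral_mono fun ω => ENNReal.tsum_le_tsum fun n => ?_
        split_ifs with hlt
        · rw [Set.indicator_of_mem (hsub n ω hlt)]
          rfl
        · exact zero_le
    _ = ∑' n : ℕ, M.P₀ S ^ n := by
        rw [lintegral_tsum fun n => (measurable_one.indicator (hm n)).aemeasurable]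
        refine tsum_congr fun n => ?_
        rw [lintegral_indicator_one (hm n), Pinf, Measure.infinitePi_pi _ fun _ _ => hSm]
        simp

lemma lintegral_alarm_le_CADD_GCuSum (θ : Θ) :
    ∫⁻ ω, ((M.GCuSum T A).alarm ω : ℝ≥0∞) ∂(M.Pchange θ 1) ≤
      M.CADD θ (M.GCuSum T A) + 1 := by
  have huniv : {ω | ((1 : ℕ) : ℕ∞) ≤ (M.GCuSum T A).alarm ω} = Set.univ :=
    Set.eq_univ_of_forall fun ω => one_le_alarm_GCuSum ω
  calc ∫⁻ ω, ((M.GCuSum T A).alarm ω : ℝ≥0∞) ∂(M.Pchange θ 1)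
      ≤ ∫⁻ ω, (((M.GCuSum T A).alarm ω : ℝ≥0∞) - ((1 : ℕ) : ℝ≥0∞)) + 1 ∂(M.Pchange θ 1) :=
        lintegral_mono fun ω => by simpa using le_tsub_add
    _ = ∫⁻ ω, (((M.GCuSum T A).alarm ω : ℝ≥0∞) - ((1 : ℕ) : ℝ≥0∞)) ∂(M.Pchange θ 1) + 1 := by
        rw [lintegral_add_right _ measurable_const]
        simp
    _ ≤ M.CADD θ (M.GCuSum T A) + 1 := by
        gcongr
        refine le_iSup₂_of_le (f := fun γ (_ : 1 ≤ γ) => ∫⁻ ω,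
          (((M.GCuSum T A).alarm ω : ℝ≥0∞) - (γ : ℝ≥0∞)) ∂(ProbabilityTheory.cond
            (M.Pchange θ γ) {ω | (γ : ℕ∞) ≤ (M.GCuSum T A).alarm ω})) 1 le_rfl ?_
        rw [huniv, cond_univ]

lemma lintegral_alarm_le_WADD_GCuSum (θ : Θ) :
    ∫⁻ ω, ((M.GCuSum T A).alarm ω : ℝ≥0∞) ∂(M.Pchange θ 1) ≤
      M.WADD θ (M.GCuSum T A) + 1 := by
  have hle : infoSigma (M.GCuSum T A).control (1 - 1) ≤ MeasurableSpace.pi :=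
    infoSigma_le (fun _ => measurable_const) _
  calc ∫⁻ ω, ((M.GCuSum T A).alarm ω : ℝ≥0∞) ∂(M.Pchange θ 1)
      ≤ ∫⁻ ω, (((M.GCuSum T A).alarm ω : ℝ≥0∞) - ((1 : ℕ) : ℝ≥0∞)) + 1 ∂(M.Pchange θ 1) :=
        lintegral_mono fun ω => by simpa using le_tsub_add
    _ = ∫⁻ ω, (((M.GCuSum T A).alarm ω : ℝ≥0∞) - ((1 : ℕ) : ℝ≥0∞)) ∂(M.Pchange θ 1) + 1 := by
        rw [lintegral_add_right _ measurable_const]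
        simp
    _ ≤ M.WADD θ (M.GCuSum T A) + 1 := by
        gcongr
        refine le_iSup₂_of_le (f := fun γ (_ : 1 ≤ γ) => essSup
          (condLExp (infoSigma (M.GCuSum T A).control (γ - 1)) (M.Pchange θ γ)
            (fun ω => ((M.GCuSum T A).alarm ω : ℝ≥0∞) - (γ : ℝ≥0∞))) (M.Pchange θ γ)) 1 le_rfl ?_
        rw [← lintegral_condLExp hle]
        refine (lintegral_mono_ae (ENNReal.ae_le_essSup _)).trans_eq ?_
        simp

/-- If the false alarm rate of a GCuSum test is small, then its detection delay is large. -/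
lemma HasFinitePosDivergences.exists_le_lintegral_alarm (hD : M.HasFinitePosDivergences) (θ : Θ)
    (K : ℕ) : ∃ c : ℝ≥0∞, 0 < c ∧ ∀ (T : Set Θ) (A : ℝ), 0 < A → (M.GCuSum T A).IsAdmissible →
      M.FAR (M.GCuSum T A) < c →
        (K : ℝ≥0∞) ≤ ∫⁻ ω, ((M.GCuSum T A).alarm ω : ℝ≥0∞) ∂(M.Pchange θ 1) := by
  obtain ⟨c, hc, hN⟩ := exists_tsum_measure_le (hD.P_ac θ) K
  refine ⟨c⁻¹, ENNReal.inv_pos.2 hc, fun T A hA hadm hFAR => ?_⟩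
  by_contra hlt
  rw [not_le, Pchange_one, lintegral_alarm_GCuSum hA hadm] at hlt
  have h := hN _ (isContinuation_noAlarm hA hadm) hlt
  rw [FAR, lintegral_alarm_GCuSum hA hadm, ENNReal.inv_lt_inv] at hFAR
  exact absurd h hFAR.not_ge

end GCuSum

/-! ### Delay metrics of policies with a uniform bound on the conditional delay -/

lemma CADD_le {Ψ : Policy 𝓧} (hΨ : Ψ.IsAdmissible) {θ : Θ} {R : ℝ≥0∞}
    (hR : ∀ γ, 1 ≤ γ → ∀ B, MeasurableSet[infoSigma Ψ.control (γ - 1)] B →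
      ∫⁻ ω in B, ((Ψ.alarm ω : ℝ≥0∞) - (γ : ℝ≥0∞)) ∂(M.Pchange θ γ) ≤ R * M.Pchange θ γ B) :
    M.CADD θ Ψ ≤ R := by
  refine iSup₂_le fun γ hγ => ?_
  rw [ProbabilityTheory.cond, lintegral_smul_measure, smul_eq_mul]
  refine (mul_le_mul_right (hR γ hγ _ (measurableSet_le_alarm hΨ hγ)) _).trans ?_
  set b := M.Pchange θ γ {ω | (γ : ℕ∞) ≤ Ψ.alarm ω}
  rw [mul_left_comm]
  exact (mul_le_mul_right (ENNReal.inv_mul_le_one b) R).trans_eq (mul_one R)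

lemma WADD_le {Ψ : Policy 𝓧} (hΨ : Ψ.IsAdmissible) {θ : Θ} {R : ℝ≥0∞}
    (hR : ∀ γ, 1 ≤ γ → ∀ B, MeasurableSet[infoSigma Ψ.control (γ - 1)] B →
      ∫⁻ ω in B, ((Ψ.alarm ω : ℝ≥0∞) - (γ : ℝ≥0∞)) ∂(M.Pchange θ γ) ≤ R * M.Pchange θ γ B) :
    M.WADD θ Ψ ≤ R := by
  refine iSup₂_le fun γ hγ => ?_
  have hle := infoSigma_le hΨ.1 (γ - 1)
  set g := condLExp (infoSigma Ψ.control (γ - 1)) (M.Pchange θ γ)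
    (fun ω => (Ψ.alarm ω : ℝ≥0∞) - (γ : ℝ≥0∞)) with hg
  refine essSup_le_of_ae_le _ ?_
  rcases eq_or_ne R ∞ with rfl | hRtop
  · exact ae_of_all _ fun _ => le_top
  have hgm : Measurable[infoSigma Ψ.control (γ - 1)] g := measurable_condLExp _ _ _
  have hB : MeasurableSet[infoSigma Ψ.control (γ - 1)] {ω | R < g ω} := hgm measurableSet_Ioi
  by_contra hae
  have hpos : M.Pchange θ γ {ω | R < g ω} ≠ 0 := by
    intro h0
    refine hae ?_
    rw [EventuallyLE, ae_iff]
    simpa using h0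
  have h1 := hR γ hγ _ hB
  rw [← setLIntegral_condLExp hle _ _ hB] at h1
  have h2 := setLIntegral_strict_mono (μ := M.Pchange θ γ) (f := fun _ => R) (hle _ hB) hpos
    (measurable_condLExp' _ _ _) (by simpa using ENNReal.mul_ne_top hRtop (measure_ne_top _ _))
    (ae_of_all _ fun ω hω => hω : ∀ᵐ ω ∂(M.Pchange θ γ), ω ∈ {ω | R < g ω} → R < g ω)
  rw [setLIntegral_const] at h2
  exact absurd h1 h2.not_ge

/-! ### The GDECuSum test -/

section GDECuSum

variable (M) (θs : Θ) (μ h : ℝ)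

/-- One step of the joint process of the buffer of used observations and the DECuSum statistic. -/
noncomputable def jointStep (z : (ℕ × (ℕ → 𝓧)) × EReal) (x : 𝓧) : (ℕ × (ℕ → 𝓧)) × EReal :=
  (if 0 ≤ z.2 then push z.1 x else z.1, M.deStep θs μ h z.2 x)

/-- The buffer of the observations used since time `s`, and the DECuSum statistic. -/
noncomputable def joint (s : ℕ) (y₀ : ℕ → 𝓧) (k : ℕ) (ω : ℕ → 𝓧) : (ℕ × (ℕ → 𝓧)) × EReal :=
  (buffer (M.deControl θs μ h) s y₀ k ω, M.pathW θs μ h (s + k) ω)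

lemma joint_succ (s : ℕ) (y₀ : ℕ → 𝓧) (k : ℕ) (ω : ℕ → 𝓧) :
    M.joint θs μ h s y₀ (k + 1) ω = M.jointStep θs μ h (M.joint θs μ h s y₀ k ω) (ω (s + k)) := by
  simp only [joint, jointStep, buffer, used_deControl_iff]
  rw [← add_assoc, pathW_succ]
  rfl

lemma isDriven_joint (s : ℕ) (y₀ : ℕ → 𝓧) :
    IsDriven s (M.jointStep θs μ h) (M.joint θs μ h s y₀) := by
  have hstep : Measurable (Function.uncurry (M.jointStep θs μ h)) := by
    refine Measurable.prodMk ?_ ((M.measurable_deStep θs μ h).comp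
      ((measurable_snd.comp measurable_fst).prodMk measurable_snd))
    exact Measurable.ite ((measurable_snd.comp measurable_fst) measurableSet_Ici)
      (measurable_push.comp ((measurable_fst.comp measurable_fst).prodMk measurable_snd))
      (measurable_fst.comp measurable_fst)
  refine ⟨hstep, fun k => ?_, M.joint_succ θs μ h s y₀, fun k ω n x hn => ?_⟩
  · induction k with
    | zero => exact measurable_const.prodMk ((M.isDriven_pathW θs μ h s).measurable_state 0)
    | succ k ih =>
      rw [funext (M.joint_succ θs μ h s y₀ k)]
      exact hstep.comp (ih.prodMk (measurable_pi_apply (s + k)))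
  · simp only [joint, buffer_update _ s y₀ hn, pathW, record_update _ hn]

variable {M θs μ h} {T : Set Θ} {A : ℝ}

lemma measurableSet_mem_noAlarm {N : ℕ → Set (ℕ → 𝓧)} (hN : IsContinuation N) :
    MeasurableSet {b : ℕ × (ℕ → 𝓧) | b.2 ∈ N b.1} := by
  refine measurableSet_setOfPred.2 (measurable_from_prod_countable_right fun p => ?_)
  exact measurableSet_setOfPred.1 (hN.measurableSet p)

/-- Whether the GDECuSum test has stopped is decided by the GCuSum continuation sets, evaluated at
the used observations. This makes the test admissible whenever the GCuSum test is. -/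
lemma isAdmissible_GDECuSum (hA : 0 < A) (hadm : (M.GCuSum T A).IsAdmissible) :
    (M.GDECuSum θs μ h T A).IsAdmissible := by
  refine ⟨M.measurable_deControl θs μ h, fun n => ?_⟩
  rcases isEmpty_or_nonempty (ℕ → 𝓧) with hemp | ⟨⟨y₀⟩⟩
  · rw [Set.eq_empty_of_isEmpty {ω | (M.GDECuSum θs μ h T A).alarm ω ≤ (n : ℕ∞)}]
    exact @MeasurableSet.empty _ (infoSigma (M.GDECuSum θs μ h T A).control n)
  have hset : {ω | (M.GDECuSum θs μ h T A).alarm ω ≤ (n : ℕ∞)} =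
      buffer (M.deControl θs μ h) 0 y₀ n ⁻¹' {b | b.2 ∈ M.noAlarm T A b.1}ᶜ :=
    Set.ext fun ω => not_lt.symm.trans (not_congr (M.lt_crossingTime_iff_buffer T _ hA y₀ n ω))
  rw [hset]
  exact measurable_buffer_infoSigma (M.deControl θs μ h) y₀ n
    (measurableSet_mem_noAlarm (isContinuation_noAlarm hA hadm)).compl

/-- Skipping observations cannot raise the false alarm rate: the used observations are again
independent with the pre-change law, and the test stops only at a used observation. In the proof,
the conditional probability that the GCuSum test survives `m` observations, given the used ones,
is a submartingale. -/
lemma FAR_GDECuSum_le (hA : 0 < A) (hadm : (M.GCuSum T A).IsAdmissible) :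
    M.FAR (M.GDECuSum θs μ h T A) ≤ M.FAR (M.GCuSum T A) := by
  have hN := isContinuation_noAlarm hA hadm
  rw [FAR, FAR, ENNReal.inv_le_inv, lintegral_alarm_GCuSum hA hadm]
  rcases isEmpty_or_nonempty (ℕ → 𝓧) with hemp | ⟨⟨y₀⟩⟩
  · have := measure_univ (μ := M.Pinf)
    rw [Set.univ_eq_empty_iff.2 hemp] at this
    simp at this
  have hdriven := M.isDriven_joint θs μ h 0 y₀
  have hmem := measurableSet_mem_noAlarm hN
  have hbm : ∀ m, MeasurableSet {ω | (buffer (M.deControl θs μ h) 0 y₀ m ω).2 ∈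
      M.noAlarm T A (buffer (M.deControl θs μ h) 0 y₀ m ω).1} := fun m =>
    (measurable_fst.comp (hdriven.measurable_state m)) hmem
  have hset : ∀ m : ℕ, {ω | (m : ℕ∞) < (M.GDECuSum θs μ h T A).alarm ω} =
      {ω | (buffer (M.deControl θs μ h) 0 y₀ m ω).2 ∈
        M.noAlarm T A (buffer (M.deControl θs μ h) 0 y₀ m ω).1} :=
    fun m => Set.ext fun ω => M.lt_crossingTime_iff_buffer T _ hA y₀ m ω
  rw [lintegral_toENNReal_eq_tsum _ fun m => by rw [hset m]; exact hbm m]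
  refine ENNReal.tsum_le_tsum fun m => ?_
  rw [hset m, ← lintegral_indicator_one (hbm m)]
  let V : (ℕ × (ℕ → 𝓧)) × EReal → ℝ≥0∞ := fun z =>
    if z.1.1 ≤ m then survival M.P₀ (M.noAlarm T A) (m - z.1.1) z.1.1 z.1.2 else 1
  have hV : Measurable V := by
    have h1 : Measurable fun b : ℕ × (ℕ → 𝓧) =>
        if b.1 ≤ m then survival M.P₀ (M.noAlarm T A) (m - b.1) b.1 b.2 else 1 := by
      refine measurable_from_prod_countable_right fun p => ?_
      by_cases hp : p ≤ m
      · simpa only [hp, if_true] using hN.measurable_survival (m - p) p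
      · simp only [hp, if_false]
        exact measurable_const
    exact h1.comp measurable_fst
  have hsub : ∀ z, V z ≤ ∫⁻ x, V (M.jointStep θs μ h z x) ∂M.P₀ := by
    rintro ⟨⟨p, y⟩, w⟩
    by_cases hw : 0 ≤ w
    · simp only [V, jointStep, hw, if_true, push]
      rcases Nat.lt_trichotomy p m with hp | rfl | hp
      · simp only [hp.le, show p + 1 ≤ m by omega, if_true]
        rw [show m - p = (m - (p + 1)) + 1 by omega]
        rfl
      · simp only [le_refl, if_true, Nat.sub_self, show ¬ p + 1 ≤ p by omega, if_false]
        simpa using (hN.survival_le_indicator 0 p y).trans (Set.indicator_le_self' (by simp) y)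
      · simp [show ¬ p ≤ m by omega, show ¬ p + 1 ≤ m by omega]
    · simp [V, jointStep, hw]
  have hmono : ∀ k, V (M.joint θs μ h 0 y₀ 0 y₀) ≤
      ∫⁻ ω, V (M.joint θs μ h 0 y₀ k ω) ∂M.Pinf := by
    intro k
    induction k with
    | zero =>
      have : ∀ ω, M.joint θs μ h 0 y₀ 0 ω = M.joint θs μ h 0 y₀ 0 y₀ := fun ω => rfl
      simp [this]
    | succ k ih =>
      refine ih.trans ?_
      rw [Pinf, hdriven.lintegral_succ (fun _ => M.P₀) hV]
      exact lintegral_mono fun ω => hsub _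
  refine le_trans (le_of_eq ?_) ((hmono m).trans (lintegral_mono fun ω => ?_))
  · simp only [V, joint, buffer, Nat.zero_le, if_true, Nat.sub_zero]
    exact (hN.survival_zero_right m y₀).symm
  · have hle := buffer_fst_le (M.deControl θs μ h) 0 y₀ m ω
    simp only [V, joint, hle, if_true]
    refine (hN.survival_le_indicator _ _ _).trans_eq ?_
    by_cases hb : (buffer (M.deControl θs μ h) 0 y₀ m ω).2 ∈
        M.noAlarm T A (buffer (M.deControl θs μ h) 0 y₀ m ω).1 <;> simp [hb]

/-- Given the information at the change, the expected delay of the GDECuSum test exceeds the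
expected stopping time of a GCuSum test that is started at the change by at most the expected
number of skipped observations, which is bounded independently of `T` and `A`. -/
lemma HasFinitePosDivergences.exists_delay_bound (hD : M.HasFinitePosDivergences)
    (hθs : M.IsLeastFavorable θs) (hμ : 0 < μ) (hh : 0 ≤ h) (θ : Θ) :
    ∃ C : ℝ≥0∞, C ≠ ∞ ∧ ∀ (T : Set Θ) (A : ℝ), 0 < A → (M.GCuSum T A).IsAdmissible →
      ∀ γ, 1 ≤ γ → ∀ B, MeasurableSet[infoSigma (M.GDECuSum θs μ h T A).control (γ - 1)] B →
        ∫⁻ ω in B, (((M.GDECuSum θs μ h T A).alarm ω : ℝ≥0∞) - (γ : ℝ≥0∞)) ∂(M.Pchange θ γ) ≤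
          (∫⁻ ω, ((M.GCuSum T A).alarm ω : ℝ≥0∞) ∂(M.Pchange θ 1) + C) * M.Pchange θ γ B := by
  obtain ⟨U, C, hU, hC, hpot⟩ := hD.exists_skip_potential hθs hμ hh θ
  refine ⟨C, hC, fun T A hA hadm γ hγ B hB => ?_⟩
  have hN := isContinuation_noAlarm hA hadm
  obtain ⟨s, rfl⟩ : ∃ s, γ = s + 1 := ⟨γ - 1, by omega⟩
  rw [Nat.add_sub_cancel] at hB
  have hBm : MeasurableSet B := infoSigma_le (M.measurable_deControl θs μ h) s _ hB
  rcases isEmpty_or_nonempty (ℕ → 𝓧) with hemp | ⟨⟨y₀⟩⟩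
  · have := measure_univ (μ := M.Pinf)
    rw [Set.univ_eq_empty_iff.2 hemp] at this
    simp at this
  have hdriven := M.isDriven_joint θs μ h s y₀
  have hmem := measurableSet_mem_noAlarm hN
  let c : (ℕ × (ℕ → 𝓧)) × EReal → ℝ≥0∞ := fun z => (M.noAlarm T A z.1.1).indicator 1 z.1.2
  have hc : Measurable c := by
    have h1 : Measurable ({b : ℕ × (ℕ → 𝓧) | b.2 ∈ M.noAlarm T A b.1}.indicator
        (1 : ℕ × (ℕ → 𝓧) → ℝ≥0∞)) := measurable_one.indicator hmem
    exact h1.comp measurable_fst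
  let V : (ℕ × (ℕ → 𝓧)) × EReal → ℝ≥0∞ := fun z =>
    remaining (M.P θ) (M.noAlarm T A) z.1.1 z.1.2 + U z.2
  have hrem : Measurable fun b : ℕ × (ℕ → 𝓧) =>
      remaining (M.P θ) (M.noAlarm T A) b.1 b.2 :=
    measurable_from_prod_countable_right fun p => hN.measurable_remaining p
  have hV : Measurable V := (hrem.comp measurable_fst).add (hU.comp measurable_snd)
  have hdrift : ∀ k ω, c (M.joint θs μ h s y₀ k ω) +
      ∫⁻ x, V (M.jointStep θs μ h (M.joint θs μ h s y₀ k ω) x)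
        ∂(if s + k + 1 < s + 1 then M.P₀ else M.P θ) ≤ V (M.joint θs μ h s y₀ k ω) + 0 := by
    have aux : ∀ (p : ℕ) (y : ℕ → 𝓧) (w : EReal),
        (if 0 ≤ w then 0 else 1) + ∫⁻ x, U (M.deStep θs μ h w x) ∂(M.P θ) ≤ U w →
        c ((p, y), w) + ∫⁻ x, V (M.jointStep θs μ h ((p, y), w) x) ∂(M.P θ) ≤ V ((p, y), w) := by
      intro p y w hp
      simp only [jointStep, V, c]
      have hdm : Measurable fun x => U (M.deStep θs μ h w x) :=
        hU.comp ((M.measurable_deStep θs μ h).comp measurable_prodMk_left)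
      rw [lintegral_add_right _ hdm]
      by_cases hw : 0 ≤ w
      · simp only [hw, if_true, zero_add, push] at hp ⊢
        rw [hN.remaining_eq p y, ← add_assoc]
        gcongr
      · simp only [hw, if_false, lintegral_const, measure_univ, mul_one] at hp ⊢
        rw [add_left_comm]
        gcongr
        refine le_trans ?_ hp
        gcongr
        exact Set.indicator_le_self' (by simp) y
    intro k ω
    rw [if_neg (by omega), add_zero]
    exact aux _ _ _ (hpot (s + k) ω).2
  have hlya := fun n => le_self_add.trans (hdriven.foster_lyapunov
    (fun i => if i + 1 < s + 1 then M.P₀ else M.P θ) hBm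
    (fun ω n x hn => update_mem_iff_of_infoSigma hB ω n x hn) hV hc 0 hdrift n)
  have hinit : ∫⁻ ω in B, V (M.joint θs μ h s y₀ 0 ω) ∂(M.Pchange θ (s + 1)) ≤
      (∫⁻ ω, ((M.GCuSum T A).alarm ω : ℝ≥0∞) ∂(M.Pchange θ 1) + C) * M.Pchange θ (s + 1) B := by
    rw [← setLIntegral_const, Pchange_one, lintegral_alarm_GCuSum hA hadm]
    refine lintegral_mono fun ω => ?_
    simp only [V, joint, buffer]
    rw [hN.remaining_zero]
    gcongr
    exact (hpot s ω).1
  have hcm : ∀ k, Measurable fun ω => c (M.joint θs μ h s y₀ k ω) := fun k =>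
    hc.comp (hdriven.measurable_state k)
  refine le_trans ?_ hinit
  calc ∫⁻ ω in B, (((M.GDECuSum θs μ h T A).alarm ω : ℝ≥0∞) - ((s + 1 : ℕ) : ℝ≥0∞))
        ∂(M.Pchange θ (s + 1))
      ≤ ∫⁻ ω in B, ∑' k, c (M.joint θs μ h s y₀ k ω) ∂(M.Pchange θ (s + 1)) := by
        refine lintegral_mono fun ω => ?_
        rw [toENNReal_sub_eq_tsum]
        refine le_trans (ENNReal.tsum_le_tsum fun n => ?_)
          (ENNReal.tsum_comp_le_tsum_of_injective (add_left_injective 1)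
            fun k => c (M.joint θs μ h s y₀ k ω))
        split_ifs with hlt
        · have := M.buffer_mem_noAlarm T (M.deControl θs μ h) hA s y₀ (n + 1) ω
            (by rw [show s + (n + 1) = s + 1 + n by omega]; exact hlt)
          simp [c, joint, this]
        · exact zero_le
    _ = ⨆ n, ∫⁻ ω in B, ∑ k ∈ Finset.range n, c (M.joint θs μ h s y₀ k ω)
          ∂(M.Pchange θ (s + 1)) := by
        simp only [ENNReal.tsum_eq_iSup_nat]
        refine lintegral_iSup (fun n => Finset.measurable_sum _ fun k _ => hcm k) ?_
        exact fun a b hab ω => Finset.sum_le_sum_of_subset (Finset.range_mono hab)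
    _ ≤ _ := iSup_le fun n => (hlya n).trans_eq (by rw [mul_zero, zero_mul, add_zero]; rfl)

end GDECuSum

/-! ### Transfer of asymptotic optimality -/

/-- A quantity `x` that exceeds a near-optimal one by a bounded amount `C` is near-optimal as soon
as the optimal value `I` is large. -/
lemma le_ofReal_mul_of_le_add {ε : ℝ} (hε : 0 < ε) {C : ℝ} (hC : 0 ≤ C) {K : ℕ}
    (hK : 1 + (1 + ε / 2) * (2 / ε * (1 + C)) ≤ K) {x D j I : ℝ≥0∞}
    (hx : x ≤ D + ENNReal.ofReal C) (hD : D ≤ j + 1) (hKD : (K : ℝ≥0∞) ≤ D)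
    (hj : j ≤ ENNReal.ofReal (1 + ε / 2) * I) : x ≤ ENNReal.ofReal (1 + ε) * I := by
  rcases eq_or_ne I ∞ with rfl | hI
  · rw [ENNReal.mul_top (by simp; linarith)]
    exact le_top
  lift I to ℝ≥0 using hI
  obtain ⟨i, hi⟩ : ∃ i : ℝ, i = I := ⟨_, rfl⟩
  have hi0 : 0 ≤ i := hi ▸ I.2
  have hIi : (I : ℝ≥0∞) = ENNReal.ofReal i := by rw [hi]; simp
  rw [hIi] at hj ⊢
  rw [← ENNReal.ofReal_mul (by linarith)] at hj ⊢
  have hm0 : 0 ≤ (1 + ε / 2) * i := by positivity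
  have hD' : D ≤ ENNReal.ofReal ((1 + ε / 2) * i + 1) := by
    rw [ENNReal.ofReal_add hm0 zero_le_one, ENNReal.ofReal_one]
    exact hD.trans (by gcongr)
  have hK' : (K : ℝ) ≤ (1 + ε / 2) * i + 1 := by
    have := hKD.trans hD'
    rw [← ENNReal.ofReal_natCast] at this
    exact (ENNReal.ofReal_le_ofReal_iff (by linarith)).1 this
  have hlarge : 2 / ε * (1 + C) ≤ i := by
    have : (1 + ε / 2) * (2 / ε * (1 + C)) ≤ (1 + ε / 2) * i := by linarith
    exact le_of_mul_le_mul_left this (by linarith)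
  have hlarge' : 1 + C ≤ ε / 2 * i := by
    calc 1 + C = ε / 2 * (2 / ε * (1 + C)) := by field_simp
      _ ≤ ε / 2 * i := by gcongr
  calc x ≤ ENNReal.ofReal ((1 + ε / 2) * i + 1) + ENNReal.ofReal C := hx.trans (by gcongr)
    _ = ENNReal.ofReal ((1 + ε / 2) * i + 1 + C) := (ENNReal.ofReal_add (by linarith) hC).symm
    _ ≤ ENNReal.ofReal ((1 + ε) * i) := ENNReal.ofReal_le_ofReal (by linarith)

/-- The transfer of optimality from the GCuSum to the GDECuSum tests, for any delay metric `J`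
that is at least the delay for a change at time one up to a constant for the GCuSum tests, and at
most that delay up to a constant for the GDECuSum tests. -/
lemma HasFinitePosDivergences.transfer (hD : M.HasFinitePosDivergences) {θs : Θ}
    {T : ℝ → Set Θ} (hT : ∀ θ, ∀ᶠ α in 𝓝[>] (0 : ℝ), θ ∈ T α) {A : ℝ → ℝ}
    {r : ℝ → ℝ} (hr : Tendsto r (𝓝[>] (0 : ℝ)) (𝓝 0)) {β : ℝ} (hβ₁ : β ≤ 1) {μ h : ℝ}
    (hPDC : M.PDC (M.deControl θs μ h) ≤ ENNReal.ofReal β) (J : Θ → Policy 𝓧 → ℝ≥0∞)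
    (hJGC : ∀ θ T A, ∫⁻ ω, ((M.GCuSum T A).alarm ω : ℝ≥0∞) ∂(M.Pchange θ 1) ≤
      J θ (M.GCuSum T A) + 1)
    (hJGD : ∀ θ, ∃ C : ℝ≥0∞, C ≠ ∞ ∧ ∀ (T : Set Θ) (A : ℝ), 0 < A →
      (M.GCuSum T A).IsAdmissible → J θ (M.GDECuSum θs μ h T A) ≤
        ∫⁻ ω, ((M.GCuSum T A).alarm ω : ℝ≥0∞) ∂(M.Pchange θ 1) + C)
    (hopt : M.UniformlyAsymptoticallyOptimal J 1 r fun α => M.GCuSum (T α) (A α)) :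
    M.UniformlyAsymptoticallyOptimal J β r fun α => M.GDECuSum θs μ h (T α) (A α) := by
  obtain ⟨hfeas, hdelay⟩ := hopt
  have hlim : Tendsto (fun α : ℝ => ENNReal.ofReal (α * (1 + r α))) (𝓝[>] (0 : ℝ)) (𝓝 0) := by
    have h1 : Tendsto (fun α : ℝ => α * (1 + r α)) (𝓝[>] (0 : ℝ)) (𝓝 (0 * (1 + 0))) :=
      (tendsto_nhdsWithin_of_tendsto_nhds tendsto_id).mul (tendsto_const_nhds.add hr)
    simpa using ENNReal.tendsto_ofReal h1
  have hFARsmall : ∀ c : ℝ≥0∞, 0 < c → ∀ᶠ α in 𝓝[>] (0 : ℝ),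
      M.FAR (M.GCuSum (T α) (A α)) < c := fun c hc => by
    filter_upwards [hfeas, hlim.eventually (gt_mem_nhds hc)] with α hα hlt
    exact hα.2.1.trans_lt hlt
  have hApos : ∀ᶠ α in 𝓝[>] (0 : ℝ), 0 < A α := by
    filter_upwards [hFARsmall _ (hD.measure_llr_nonneg_pos θs), hT θs] with α hα hθ
    by_contra hA
    exact absurd (FAR_GCuSum_ge_of_nonpos hθ (not_lt.1 hA)) hα.not_ge
  refine ⟨?_, fun θ ε hε => ?_⟩
  · filter_upwards [hfeas, hApos] with α hα hA
    exact ⟨isAdmissible_GDECuSum hA hα.1, (FAR_GDECuSum_le hA hα.1).trans hα.2.1, hPDC⟩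
  · obtain ⟨C, hC, hGD⟩ := hJGD θ
    obtain ⟨K, hK⟩ := exists_nat_ge (1 + (1 + ε / 2) * (2 / ε * (1 + C.toReal)))
    obtain ⟨c, hc, hlarge⟩ := hD.exists_le_lintegral_alarm θ K
    filter_upwards [hfeas, hApos, hFARsmall c hc, hdelay θ (ε / 2) (by linarith)]
      with α hα hA hFAR hnear
    refine le_ofReal_mul_of_le_add hε ENNReal.toReal_nonneg hK (j := J θ (M.GCuSum (T α) (A α)))
      (D := ∫⁻ ω, ((M.GCuSum (T α) (A α)).alarm ω : ℝ≥0∞) ∂(M.Pchange θ 1)) ?_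
      (hJGC θ (T α) (A α)) (hlarge _ _ hA hα.1 hFAR) (hnear.trans ?_)
    · rw [ENNReal.ofReal_toReal hC]
      exact hGD _ _ hA hα.1
    · -- the policies with duty cycle at most `β` are among those with duty cycle at most one
      gcongr with Ψ
      refine le_iInf fun hΨ => iInf_le_of_le ⟨hΨ.1, hΨ.2.1, hΨ.2.2.trans ?_⟩ le_rfl
      exact ENNReal.ofReal_le_ofReal hβ₁

end Model

end QCD

theorem corollary1 {𝓧 Θ : Type*} [MeasurableSpace 𝓧] (M : QCD.Model 𝓧 Θ)
    (hD : M.HasFinitePosDivergences)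
    (θs : Θ) (hθs : M.IsLeastFavorable θs)
    -- the parameter sets `Θ'(α)` and thresholds `A_α` of the tests
    (T : ℝ → Set Θ) (hT : ∀ θ, ∀ᶠ α in 𝓝[>] (0 : ℝ), θ ∈ T α) (A : ℝ → ℝ)
    -- the tolerance in the false alarm constraint
    (r : ℝ → ℝ) (hr : Tendsto r (𝓝[>] (0 : ℝ)) (𝓝 0))
    (β : ℝ) (hβ₀ : 0 < β) (hβ₁ : β ≤ 1) :
    -- the duty cycle constraint can be met by the choice of `μ`, for every `h > 0`
    (∀ h : ℝ, 0 < h → ∃ μ₀ : ℝ, 0 < μ₀ ∧ ∀ μ : ℝ, 0 < μ → μ ≤ μ₀ →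
      M.PDC (M.deControl θs μ h) ≤ ENNReal.ofReal β) ∧
    -- transfer of optimality, whenever the duty cycle constraint is met
    (∀ μ h : ℝ, 0 < μ → 0 ≤ h → M.PDC (M.deControl θs μ h) ≤ ENNReal.ofReal β →
      (M.UniformlyAsymptoticallyOptimal M.CADD 1 r (fun α => M.GCuSum (T α) (A α)) →
        M.UniformlyAsymptoticallyOptimal M.CADD β r
          (fun α => M.GDECuSum θs μ h (T α) (A α))) ∧
      (M.UniformlyAsymptoticallyOptimal M.WADD 1 r (fun α => M.GCuSum (T α) (A α)) →
        M.UniformlyAsymptoticallyOptimal M.WADD β r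
          (fun α => M.GDECuSum θs μ h (T α) (A α)))) := by
  refine ⟨fun h hh => hD.exists_PDC_le θs hβ₀ hh, fun μ h hμ hh hPDC => ⟨?_, ?_⟩⟩
  · refine hD.transfer hT hr hβ₁ hPDC M.CADD
      (fun θ _ _ => QCD.Model.lintegral_alarm_le_CADD_GCuSum θ) fun θ => ?_
    obtain ⟨C, hC, hbound⟩ := hD.exists_delay_bound hθs hμ hh θ
    exact ⟨C, hC, fun T A hA hadm => QCD.Model.CADD_le
      (QCD.Model.isAdmissible_GDECuSum hA hadm) (hbound T A hA hadm)⟩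
  · refine hD.transfer hT hr hβ₁ hPDC M.WADD
      (fun θ _ _ => QCD.Model.lintegral_alarm_le_WADD_GCuSum θ) fun θ => ?_
    obtain ⟨C, hC, hbound⟩ := hD.exists_delay_bound hθs hμ hh θ
    exact ⟨C, hC, fun T A hA hadm => QCD.Model.WADD_le
      (QCD.Model.isAdmissible_GDECuSum hA hadm) (hbound T A hA hadm)⟩
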